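/- For $f\in L_2(-\pi,\pi)$ real-valued put $\gamma_f(k)=\int_{-\pi}^{\pi}e^{\mathrm{i}k\omega}f(\omega)\,d\omega$, $k\in\mathbb{Z}$. For $M>0$ and $\alpha>1/2$ let $\Sigma=\Sigma_{\alpha,M}$ be the set of all even functions $f\in L_2(-\pi,\pi)$ with $f(\omega)\ge M^{-1}$ for $\omega\in[-\pi,\pi]$ and $$\gamma_f(0)^2+\sum_{k=-\infty}^{\infty}|k|^{2\alpha}\gamma_f(k)^2\le M .$$ Let $\mathcal{E}_n=\bigl(N_n(0,\Gamma_n(f)),\,f\in\Sigma\bigr)$, where $\Gamma_n(f)=(\gamma_f(k-j))_{j,k=1,\dots,n}$, be the experiment of observing $y(1),\dots,y(n)$ from a stationary centered Gaussian sequence with spectral density $f$. Let $\mathring{\mathcal{E}}_m=\bigl(N_m(0,\mathrm{Diag}(J_{1,m}(f),\dots,J_{m,m}(f))),\,f\in\Sigma\bigr)$, where $J_{j,m}(f)=m\int_{(j-1)/m}^{j/m}f(2\pi x-\pi)\,dx$, be the Gaussian scale experiment with grid size $m$. For experiments $\mathcal{F}=(Q_f,\,f\in\Sigma)$ and $\mathcal{E}=(P_f,\,f\in\Sigma)$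 let $$\delta(\mathcal{F},\mathcal{E})=\inf_K\sup_{f\in\Sigma}\|P_f-KQ_f\|_{TV}$$ be the deficiency of $\mathcal{F}$ with respect to $\mathcal{E}$, the infimum being over all Markov kernels $K$ from the sample space of $\mathcal{F}$ to that of $\mathcal{E}$. Let $r_n=2[\log(n/2)]$, where $[\cdot]$ denotes the integer part. Then, as $n\to\infty$ through the odd integers, $\mathcal{E}_n$ is asymptotically less informative than $\mathring{\mathcal{E}}_{n+r_n}$, that is, $$\delta\bigl(\mathring{\mathcal{E}}_{n+r_n},\,\mathcal{E}_n\bigr)\to 0 .$$ -/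

import Mathlib

open MeasureTheory ProbabilityTheory Filter Topology
open scoped ENNReal

noncomputable section

namespace SpectralExperiment

/-! ### Comparison of statistical experiments

An experiment with parameter set `Θ` and sample space `Ω` is a family `P : Θ → Measure Ω`. -/

/-- Total variation distance `sup_A |P(A) - Q(A)|` of two (finite) measures on the same space. -/
def tvDist {Ω : Type*} [MeasurableSpace Ω] (P Q : Measure Ω) : ℝ≥0∞ :=
  ⨆ (A : Set Ω) (_ : MeasurableSet A), ENNReal.ofReal |P.real A - Q.real A|

/-- The deficiency `δ(P, Q) = inf_K sup_θ ‖Q_θ - K P_θ‖_TV`, with the infimum over all Markov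
kernels `K` from the sample space of `P` to the sample space of `Q`. -/
def deficiency {Θ Ω Ω' : Type*} [MeasurableSpace Ω] [MeasurableSpace Ω']
    (P : Θ → Measure Ω) (Q : Θ → Measure Ω') : ℝ≥0∞ :=
  ⨅ (K : Kernel Ω Ω') (_ : IsMarkovKernel K), ⨆ θ : Θ, tvDist (Q θ) ((P θ).bind K)

/-- Along the filter `l`, the sequence `E` is asymptotically less informative than `F`:
`δ(F_n, E_n) → 0`. -/
def AsympLessInformative {Θ : Type*} {Ω Ω' : ℕ → Type*}
    [∀ n, MeasurableSpace (Ω n)] [∀ n, MeasurableSpace (Ω' n)] (l : Filter ℕ)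
    (E : ∀ n, Θ → Measure (Ω n)) (F : ∀ n, Θ → Measure (Ω' n)) : Prop :=
  Tendsto (fun n => deficiency (F n) (E n)) l (𝓝 0)

/-! ### Spectral densities

A function on `[-π, π]` is represented by a function `ℝ → ℝ` of which only the values on
`[-π, π]` are used. -/

/-- `∫_{-π}^{π} exp(i k ω) f(ω) dω`. -/
def fourierCoef (f : ℝ → ℝ) (k : ℤ) : ℂ :=
  ∫ ω in (-Real.pi)..Real.pi, Complex.exp (Complex.I * (k : ℂ) * (ω : ℂ)) * (f ω : ℂ)

/-- The autocovariance function `γ_f`. For even `f` the coefficient `fourierCoef f k` is real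
(`coe_autocov`), so that taking the real part only changes the type. -/
def autocov (f : ℝ → ℝ) (k : ℤ) : ℝ := (fourierCoef f k).re

/-- For even `f` one has `γ_f(k) = ∫_{-π}^{π} exp(i k ω) f(ω) dω`. -/
theorem coe_autocov {f : ℝ → ℝ} (hf : ∀ ω ∈ Set.Icc (-Real.pi) Real.pi, f (-ω) = f ω) (k : ℤ) :
    (autocov f k : ℂ) = fourierCoef f k := by
  rw [autocov, ← Complex.conj_eq_iff_re, fourierCoef, ← intervalIntegral.intervalIntegral_conj]
  have h := intervalIntegral.integral_comp_neg (a := -Real.pi) (b := Real.pi)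
    (fun ω : ℝ => Complex.exp (Complex.I * (k : ℂ) * (ω : ℂ)) * (f ω : ℂ))
  rw [neg_neg] at h
  rw [← h]
  refine intervalIntegral.integral_congr fun ω hω => ?_
  rw [Set.uIcc_of_le (by linarith [Real.pi_pos])] at hω
  simp [← Complex.exp_conj, hf ω hω]

/-- The set `F_M` of even functions on `[-π, π]` bounded below by `M⁻¹`. -/
def lowerBoundedEven (M : ℝ) : Set (ℝ → ℝ) :=
  {f | ∀ ω ∈ Set.Icc (-Real.pi) Real.pi, M⁻¹ ≤ f ω ∧ f ω = f (-ω)}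

/-- The periodic Sobolev ball `W^α(M)`: the `f ∈ L₂(-π, π)` with
`|γ_f(0)|² + ∑_k |k|^{2α} |γ_f(k)|² ≤ M`. -/
def sobolevBall (α M : ℝ) : Set (ℝ → ℝ) :=
  {f | MemLp f 2 (volume.restrict (Set.Icc (-Real.pi) Real.pi)) ∧
    Summable (fun k : ℤ => |(k : ℝ)| ^ (2 * α) * ‖fourierCoef f k‖ ^ 2) ∧
    ‖fourierCoef f 0‖ ^ 2 + ∑' k : ℤ, |(k : ℝ)| ^ (2 * α) * ‖fourierCoef f k‖ ^ 2 ≤ M}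

/-- The parameter space `Σ_{α,M} = W^α(M) ∩ F_M`. -/
def densityClass (α M : ℝ) : Set (ℝ → ℝ) := sobolevBall α M ∩ lowerBoundedEven M

/-! ### The two experiments -/

/-- The Toeplitz covariance matrix `Γ_n(f) = (γ_f(k - j))_{j,k}`. -/
def toeplitzCov (n : ℕ) (f : ℝ → ℝ) : Matrix (Fin n) (Fin n) ℝ :=
  Matrix.of fun j k => autocov f (((k : ℕ) : ℤ) - ((j : ℕ) : ℤ))

/-- The time series experiment `E_n = (N_n(0, Γ_n(f)), f ∈ S)`. -/
def timeSeries (S : Set (ℝ → ℝ)) (n : ℕ) : S → Measure (EuclideanSpace ℝ (Fin n)) :=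
  fun f => multivariateGaussian 0 (toeplitzCov n f)

/-- The local average `n ∫_{j/n}^{(j+1)/n} f(2πx - π) dx`; here `j` runs through `0, …, n - 1`
in place of `1, …, n`. -/
def localAverage (n : ℕ) (f : ℝ → ℝ) (j : Fin n) : ℝ :=
  (n : ℝ) * ∫ x in (((j : ℕ) : ℝ) / (n : ℝ))..((((j : ℕ) : ℝ) + 1) / (n : ℝ)),
    f (2 * Real.pi * x - Real.pi)

/-- The Gaussian scale experiment of grid size `n`: independent `N(0, J_{j,n}(f))`, `f ∈ S`. -/
def gaussianScale (S : Set (ℝ → ℝ)) (n : ℕ) : S → Measure (EuclideanSpace ℝ (Fin n)) :=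
  fun f => multivariateGaussian 0 (Matrix.diagonal (localAverage n f))

/-- `r_n = 2 [log(n/2)]`, with `[·]` the integer part (only `n ≥ 2` is relevant). -/
def extraGrid (n : ℕ) : ℕ := 2 * ⌊Real.log ((n : ℝ) / 2)⌋₊

end SpectralExperiment

end

noncomputable section

namespace SpectralExperiment

/-! ### Total variation distance -/

/-! A single linear map, the same for every `f`, carries the scale experiment close to the time
series. Put `m = n + r = 2q + 1` and let `G = hartley n q` consist of `n` rows of the Hartley
transform. Since `m` is odd, the midpoints of the cells are exactly the frequencies `2πl/m`, `|l| ≤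
q`. Since `f` is even, its local averages `J` are symmetric, and `G diag(J) Gᵀ` is a Toeplitz
matrix, a section of a symmetric circulant (`hartley_mul_diagonal_mul_transpose`).

This matrix is compared with `Γ_n(f)` in the Hilbert-Schmidt norm, with two errors. Replacing `J` by
the truncated Fourier series of `f` on the grid costs at most a multiple of `m^(1-2β)` in square
(`sum_sq_cellAverage_sub_cosSum_le`, `sum_sq_gridSum_le`). The circulant so obtained has entry
`γ(k)` for `|k| ≤ q` and the wrapped entry `γ(m - |k|)` beyond. As `|k| < n`, only lags of size at
least `r + 1` are affected, and the Sobolev weight bounds the squared error by a multiple of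
`(r+1)^(1-2β)` (`sum_sq_sub_circulantCov_le`). Here `β = min α 1 > 1/2`; the extra grid points make
`r`, and with it the rate, effective.

Finally `G Gᵀ = 2π` and `J ≥ M⁻¹` bound the covariance `G diag(J) Gᵀ` away from zero, so
Hilbert-Schmidt closeness gives closeness in total variation (`tvDist_multivariateGaussian_le`), by
simultaneous diagonalization and a chi-square bound for products. All constants depend on `α` and
`M` only, hence uniformity over the class. -/

theorem tvDist_comm {Ω : Type*} [MeasurableSpace Ω] (P Q : Measure Ω) :
    tvDist P Q = tvDist Q P := by
  simp only [tvDist, abs_sub_comm]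

theorem tvDist_map_le {Ω Ω' : Type*} [MeasurableSpace Ω] [MeasurableSpace Ω'] {g : Ω → Ω'}
    (hg : Measurable g) (P Q : Measure Ω) : tvDist (P.map g) (Q.map g) ≤ tvDist P Q := by
  refine iSup₂_le fun A hA => ?_
  rw [map_measureReal_apply hg hA, map_measureReal_apply hg hA]
  exact le_iSup₂ (f := fun (A : Set Ω) (_ : MeasurableSet A) =>
    ENNReal.ofReal |P.real A - Q.real A|) (g ⁻¹' A) (hg hA)

/-- The total variation distance is bounded by the square root of the chi-square divergence. -/
theorem tvDist_withDensity_le {Ω : Type*} [MeasurableSpace Ω] (P : Measure Ω)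
    [IsProbabilityMeasure P] {ρ : Ω → ℝ} (hρ : MemLp ρ 2 P) (h0 : 0 ≤ ρ)
    (h1 : ∫ x, ρ x ∂P = 1) :
    tvDist P (P.withDensity fun x => ENNReal.ofReal (ρ x)) ≤
      ENNReal.ofReal (√(∫ x, ρ x ^ 2 ∂P - 1)) := by
  have hfint : Integrable ρ P := hρ.integrable one_le_two
  have hsub : MemLp (fun x => ρ x - 1) 2 P := hρ.sub (memLp_const 1)
  have habs : Integrable (fun x => |ρ x - 1|) P := (hfint.sub (integrable_const 1)).abs
  refine iSup₂_le fun A hA => ENNReal.ofReal_le_ofReal ?_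
  have e1 : (P.withDensity fun x => ENNReal.ofReal (ρ x)).real A = ∫ x in A, ρ x ∂P := by
    rw [measureReal_def, withDensity_apply _ hA,
      integral_eq_lintegral_of_nonneg_ae (ae_of_all _ h0) hfint.aestronglyMeasurable.restrict]
  have e2 : P.real A = ∫ x in A, (1 : ℝ) ∂P := by simp
  have hvar : Var[ρ; P] = ∫ x, ρ x ^ 2 ∂P - 1 := by
    rw [variance_eq_sub hρ, h1]; simp
  have hvar2 : Var[ρ; P] = ∫ x, (ρ x - 1) ^ 2 ∂P := by
    rw [variance_eq_integral hfint.aemeasurable, h1]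
  -- Jensen's inequality, in the form that the variance of `|ρ - 1|` is nonnegative.
  have hvar3 : (∫ x, |ρ x - 1| ∂P) ^ 2 ≤ ∫ x, (ρ x - 1) ^ 2 ∂P := by
    have := variance_eq_sub (μ := P) hsub.abs
    have h0 := variance_nonneg |fun x => ρ x - 1| P
    rw [this] at h0
    simpa using h0
  rw [e1, abs_sub_comm, e2, ← integral_sub hfint.integrableOn (integrable_const _).integrableOn]
  calc |∫ x in A, (ρ x - 1) ∂P| ≤ ∫ x in A, |ρ x - 1| ∂P := abs_integral_le_integral_abs
    _ ≤ ∫ x, |ρ x - 1| ∂P := setIntegral_le_integral habs (ae_of_all _ fun _ => abs_nonneg _)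
    _ ≤ √(∫ x, ρ x ^ 2 ∂P - 1) := by
        apply Real.le_sqrt_of_sq_le
        rw [← hvar, hvar2]; exact hvar3

/-! ### Products of centered Gaussian measures -/

/-- A product of probability densities is the density of the product measure. -/
theorem pi_withDensity_ofReal {ι : Type*} [Fintype ι] {Ω : ι → Type*}
    [∀ i, MeasurableSpace (Ω i)] (P : ∀ i, Measure (Ω i)) [∀ i, SigmaFinite (P i)]
    {ρ : ∀ i, Ω i → ℝ} (h0 : ∀ i, 0 ≤ ρ i) (hfint : ∀ i, Integrable (ρ i) (P i)) :
    Measure.pi (fun i => (P i).withDensity fun x => ENNReal.ofReal (ρ i x)) =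
      (Measure.pi P).withDensity fun x => ENNReal.ofReal (∏ i, ρ i (x i)) := by
  have hfin : ∀ i, IsFiniteMeasure ((P i).withDensity fun x => ENNReal.ofReal (ρ i x)) :=
    fun i => isFiniteMeasure_withDensity_ofReal (hfint i).hasFiniteIntegral
  refine Measure.pi_eq fun s hs => ?_
  rw [withDensity_apply _ (MeasurableSet.univ_pi hs), Measure.restrict_pi_pi,
    ← ofReal_integral_eq_lintegral_ofReal
      (Integrable.fintype_prod_dep fun i => (hfint i).restrict)
      (ae_of_all _ fun x => Finset.prod_nonneg fun i _ => h0 i (x i)),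
    integral_fintype_prod_eq_prod,
    ENNReal.ofReal_prod_of_nonneg fun i _ => integral_nonneg (h0 i)]
  refine Finset.prod_congr rfl fun i _ => ?_
  rw [withDensity_apply _ (hs i),
    ofReal_integral_eq_lintegral_ofReal (hfint i).restrict (ae_of_all _ (h0 i))]

/-- The density of `N(0, v)` with respect to `N(0, 1)`. -/
def gaussianRatio (v : NNReal) (x : ℝ) : ℝ := gaussianPDFReal 0 v x / gaussianPDFReal 0 1 x

theorem gaussianRatio_nonneg (v : NNReal) : 0 ≤ gaussianRatio v :=
  fun x => div_nonneg (gaussianPDFReal_nonneg 0 v x) (gaussianPDFReal_nonneg 0 1 x)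

theorem measurable_gaussianRatio (v : NNReal) : Measurable (gaussianRatio v) :=
  (measurable_gaussianPDFReal 0 v).div (measurable_gaussianPDFReal 0 1)

theorem gaussianPDFReal_mul_gaussianRatio (v : NNReal) (x : ℝ) :
    gaussianPDFReal 0 1 x * gaussianRatio v x = gaussianPDFReal 0 v x :=
  mul_div_cancel₀ _ (gaussianPDFReal_pos 0 1 x one_ne_zero).ne'

theorem gaussianReal_eq_withDensity_ratio {v : NNReal} (hv : v ≠ 0) :
    gaussianReal 0 v =
      (gaussianReal 0 1).withDensity fun x => ENNReal.ofReal (gaussianRatio v x) := by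
  rw [gaussianReal_of_var_ne_zero 0 hv, gaussianReal_of_var_ne_zero 0 one_ne_zero,
    ← withDensity_mul _ (measurable_gaussianPDF 0 1) (measurable_gaussianRatio v).ennreal_ofReal]
  congr 1
  ext x
  simp only [gaussianPDF, Pi.mul_apply]
  rw [← ENNReal.ofReal_mul (gaussianPDFReal_nonneg 0 1 x), gaussianPDFReal_mul_gaussianRatio]

theorem integral_gaussianReal_std (g : ℝ → ℝ) :
    ∫ x, g x ∂gaussianReal 0 1 = ∫ x, gaussianPDFReal 0 1 x * g x := by
  simpa using integral_gaussianReal_eq_integral_smul (μ := 0) (f := g) (one_ne_zero (α := NNReal))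

theorem integrable_gaussianReal_std_iff (g : ℝ → ℝ) :
    Integrable g (gaussianReal 0 1) ↔ Integrable fun x => gaussianPDFReal 0 1 x * g x := by
  rw [gaussianReal_of_var_ne_zero 0 one_ne_zero,
    integrable_withDensity_iff_integrable_smul' (measurable_gaussianPDF 0 1)
      (ae_of_all _ fun x => gaussianPDF_lt_top)]
  simp [toReal_gaussianPDF]

theorem integrable_gaussianRatio (v : NNReal) :
    Integrable (gaussianRatio v) (gaussianReal 0 1) := by
  rw [integrable_gaussianReal_std_iff]
  simp only [gaussianPDFReal_mul_gaussianRatio]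
  exact integrable_gaussianPDFReal 0 v

theorem integral_gaussianRatio {v : NNReal} (hv : v ≠ 0) :
    ∫ x, gaussianRatio v x ∂gaussianReal 0 1 = 1 := by
  rw [integral_gaussianReal_std]
  simp only [gaussianPDFReal_mul_gaussianRatio]
  exact integral_gaussianPDFReal_eq_one 0 hv

/-- The product is `φ_v² / φ_1`, again a Gaussian profile. Its exponent is negative exactly when `v
< 2`, whence that restriction below. -/
theorem gaussianPDFReal_mul_gaussianRatio_sq {v : NNReal} (hv : v ≠ 0) (x : ℝ) :
    gaussianPDFReal 0 1 x * gaussianRatio v x ^ 2 =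
      (√(2 * Real.pi) * v)⁻¹ * Real.exp (-((2 - v) / (2 * v)) * x ^ 2) := by
  have hv' : (0 : ℝ) < v := by positivity
  have hp : (0 : ℝ) < 2 * Real.pi := by positivity
  rw [sq, ← mul_assoc, gaussianPDFReal_mul_gaussianRatio, gaussianRatio]
  simp only [gaussianPDFReal, NNReal.coe_one, mul_one, sub_zero]
  have hs : √(2 * Real.pi * v) = √(2 * Real.pi) * √v := Real.sqrt_mul hp.le _
  have hsv : √(v : ℝ) * √v = v := Real.mul_self_sqrt hv'.le
  have hexp : Real.exp (-x ^ 2 / (2 * v)) * (Real.exp (-x ^ 2 / (2 * v)) / Real.exp (-x ^ 2 / 2)) =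
      Real.exp (-((2 - v) / (2 * v)) * x ^ 2) := by
    rw [← Real.exp_sub, ← Real.exp_add]; congr 1; field_simp; ring
  rw [← hexp, hs]
  have h1 : √(2 * Real.pi) ≠ 0 := by positivity
  have h2 : √(v : ℝ) ≠ 0 := by positivity
  have h3 : (√(2 * Real.pi) * (v : ℝ))⁻¹ = (√(2 * Real.pi) * (√v * √v))⁻¹ := by rw [hsv]
  rw [h3]
  field_simp

theorem memLp_gaussianRatio {v : NNReal} (hv : v ≠ 0) (h2 : (v : ℝ) < 2) :
    MemLp (gaussianRatio v) 2 (gaussianReal 0 1) := by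
  rw [memLp_two_iff_integrable_sq (measurable_gaussianRatio v).aestronglyMeasurable,
    integrable_gaussianReal_std_iff]
  simp only [gaussianPDFReal_mul_gaussianRatio_sq hv]
  have hv' : (0 : ℝ) < v := by positivity
  exact (integrable_exp_neg_mul_sq (div_pos (by linarith) (by linarith))).const_mul _

/-- The identity `v (2 - v) = 1 - (v - 1)²` makes the deviation `v - 1` enter quadratically, which
is what later matches the Hilbert-Schmidt norm. -/
theorem integral_gaussianRatio_sq {v : NNReal} (hv : v ≠ 0) (h2 : (v : ℝ) < 2) :
    ∫ x, gaussianRatio v x ^ 2 ∂gaussianReal 0 1 = (√(1 - ((v : ℝ) - 1) ^ 2))⁻¹ := by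
  have hv' : (0 : ℝ) < v := by positivity
  rw [integral_gaussianReal_std]
  simp only [gaussianPDFReal_mul_gaussianRatio_sq hv]
  rw [integral_const_mul, integral_gaussian]
  have h3 : (0 : ℝ) < 2 - v := by linarith
  have e1 : Real.pi / ((2 - v) / (2 * v)) = (2 * Real.pi) * v ^ 2 / (1 - ((v : ℝ) - 1) ^ 2) := by
    have : (1 - ((v : ℝ) - 1) ^ 2) = v * (2 - v) := by ring
    rw [this]; field_simp
  rw [e1, Real.sqrt_div (by positivity), Real.sqrt_mul (x := 2 * Real.pi) (by positivity),
    Real.sqrt_sq hv'.le]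
  have : √(2 * Real.pi) ≠ 0 := by positivity
  field_simp

theorem inv_sqrt_one_sub_le {t : ℝ} (h0 : 0 ≤ t) (h1 : t ≤ 1 / 2) : (√(1 - t))⁻¹ ≤ Real.exp t := by
  rw [inv_le_comm₀ (Real.sqrt_pos.2 (by linarith)) (Real.exp_pos t), ← Real.exp_neg]
  apply Real.le_sqrt_of_sq_le
  rw [← Real.exp_nat_mul]
  -- It remains that `(1 + 2t)(1 - t) ≥ 1`, that is `t (1 - 2t) ≥ 0`. The factor `1` fits
  -- `inv_mul_le_iff₀`.
  have h2 : Real.exp (-(2 * t)) ≤ (1 + 2 * t)⁻¹ * 1 := by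
    rw [Real.exp_neg, mul_one]
    exact inv_anti₀ (by linarith) (by linarith [Real.add_one_le_exp (2 * t)])
  calc Real.exp ((2 : ℕ) * -t) = Real.exp (-(2 * t)) := by congr 1; push_cast; ring
    _ ≤ (1 + 2 * t)⁻¹ * 1 := h2
    _ ≤ 1 - t := by
      rw [inv_mul_le_iff₀ (by linarith)]; nlinarith

theorem exp_sub_one_le_two_mul {t : ℝ} (h0 : 0 ≤ t) (h1 : t ≤ 1 / 2) : Real.exp t - 1 ≤ 2 * t := by
  have h := Real.exp_bound_div_one_sub_of_interval h0 (by linarith)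
  have h2 : 1 / (1 - t) ≤ 1 + 2 * t := by
    rw [div_le_iff₀ (by linarith)]; nlinarith
  linarith

/-- The second moment of the likelihood ratio is multiplicative, hence at most `exp (∑ (v i - 1)²)`.
The bound `1/2` serves three times: it forces `v i ≠ 0`, it forces `v i < 2`, and it linearizes the
exponential. -/
theorem tvDist_pi_gaussianReal_le {ι : Type*} [Fintype ι] {v : ι → NNReal}
    (hv : ∑ i, ((v i : ℝ) - 1) ^ 2 ≤ 1 / 2) :
    tvDist (Measure.pi fun _ : ι => gaussianReal 0 1) (Measure.pi fun i => gaussianReal 0 (v i)) ≤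
      ENNReal.ofReal (√(2 * ∑ i, ((v i : ℝ) - 1) ^ 2)) := by
  have hle : ∀ i, ((v i : ℝ) - 1) ^ 2 ≤ 1 / 2 := fun i =>
    (Finset.single_le_sum (f := fun i => ((v i : ℝ) - 1) ^ 2) (fun _ _ => sq_nonneg _)
      (Finset.mem_univ i)).trans hv
  have h0 : ∀ i, v i ≠ 0 := fun i h => by
    have := hle i; rw [h] at this; norm_num at this
  have h2 : ∀ i, (v i : ℝ) < 2 := fun i => by nlinarith [hle i]
  have hpi := pi_withDensity_ofReal (fun _ : ι => gaussianReal 0 1)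
    (fun i => gaussianRatio_nonneg (v i)) (fun i => integrable_gaussianRatio (v i))
  simp_rw [← gaussianReal_eq_withDensity_ratio (h0 _)] at hpi
  have hsq : ∀ x : ι → ℝ, (∏ i, gaussianRatio (v i) (x i)) ^ 2 =
      ∏ i, gaussianRatio (v i) (x i) ^ 2 := fun x => (Finset.prod_pow _ _ _).symm
  have hmem : MemLp (fun x : ι → ℝ => ∏ i, gaussianRatio (v i) (x i)) 2
      (Measure.pi fun _ : ι => gaussianReal 0 1) := by
    rw [memLp_two_iff_integrable_sq]
    · simp only [hsq]
      exact Integrable.fintype_prod (f := fun i x => gaussianRatio (v i) x ^ 2) fun i =>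
        (memLp_gaussianRatio (h0 i) (h2 i)).integrable_sq
    · exact (Finset.measurable_fun_prod _ fun i _ => (measurable_gaussianRatio (v i)).comp
        (measurable_pi_apply i)).aestronglyMeasurable
  rw [hpi]
  refine (tvDist_withDensity_le _ hmem
    (fun x => Finset.prod_nonneg fun i _ => gaussianRatio_nonneg (v i) (x i)) ?_).trans
    (ENNReal.ofReal_le_ofReal (Real.sqrt_le_sqrt ?_))
  · rw [integral_fintype_prod_eq_prod]
    exact Finset.prod_eq_one fun i _ => integral_gaussianRatio (h0 i)
  · simp only [hsq]
    rw [integral_fintype_prod_eq_prod (f := fun i x => gaussianRatio (v i) x ^ 2)]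
    have hprod : ∏ i, ∫ x, gaussianRatio (v i) x ^ 2 ∂gaussianReal 0 1 ≤
        Real.exp (∑ i, ((v i : ℝ) - 1) ^ 2) := by
      rw [Real.exp_sum]
      refine Finset.prod_le_prod (fun i _ => integral_nonneg fun x => sq_nonneg _) fun i _ => ?_
      rw [integral_gaussianRatio_sq (h0 i) (h2 i)]
      exact inv_sqrt_one_sub_le (sq_nonneg _) (hle i)
    linarith [exp_sub_one_le_two_mul (Finset.sum_nonneg fun i _ => sq_nonneg ((v i : ℝ) - 1)) hv]

/-! ### Multivariate centered Gaussian measures -/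

theorem inner_toEuclideanLin_transpose {ι κ : Type*} [Fintype ι] [DecidableEq ι] [Fintype κ]
    [DecidableEq κ] (G : Matrix κ ι ℝ) (x : EuclideanSpace ℝ ι) (t : EuclideanSpace ℝ κ) :
    inner ℝ (G.toEuclideanLin x) t = inner ℝ x (G.transpose.toEuclideanLin t) := by
  simp only [EuclideanSpace.inner_eq_star_dotProduct, Matrix.ofLp_toLpLin, Matrix.toLin'_apply,
    star_trivial]
  rw [Matrix.dotProduct_mulVec, Matrix.mulVec_transpose]

theorem map_multivariateGaussian {ι κ : Type*} [Fintype ι] [DecidableEq ι] [Fintype κ]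
    [DecidableEq κ] {S : Matrix ι ι ℝ} (hS : S.PosSemidef) (G : Matrix κ ι ℝ) :
    (multivariateGaussian 0 S).map (G.toEuclideanLin) =
      multivariateGaussian 0 (G * S * G.transpose) := by
  have hc : Continuous G.toEuclideanLin := LinearMap.continuous_of_finiteDimensional _
  have hS' : (G * S * G.transpose).PosSemidef := by
    have := hS.mul_mul_conjTranspose_same G
    rwa [Matrix.conjTranspose_eq_transpose_of_trivial] at this
  have : IsProbabilityMeasure ((multivariateGaussian 0 S).map G.toEuclideanLin) :=
    Measure.isProbabilityMeasure_map hc.aemeasurable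
  apply Measure.ext_of_charFun
  ext t
  rw [charFun_apply, integral_map hc.aemeasurable (by fun_prop)]
  simp only [inner_toEuclideanLin_transpose]
  rw [← charFun_apply, charFun_multivariateGaussian hS, charFun_multivariateGaussian hS']
  simp only [inner_zero_right, Matrix.ofLp_toLpLin, Matrix.toLin'_apply]
  rw [← Matrix.mulVec_mulVec, ← Matrix.mulVec_mulVec, Matrix.dotProduct_mulVec _ G,
    Matrix.mulVec_transpose]

theorem multivariateGaussian_diagonal {ι : Type*} [Fintype ι] [DecidableEq ι] (v : ι → NNReal) :
    multivariateGaussian 0 (Matrix.diagonal fun i => (v i : ℝ)) =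
      (Measure.pi fun i => gaussianReal 0 (v i)).map (WithLp.toLp 2) := by
  have : IsProbabilityMeasure ((Measure.pi fun i => gaussianReal 0 (v i)).map
      (WithLp.toLp 2)) := Measure.isProbabilityMeasure_map (by fun_prop)
  apply Measure.ext_of_charFun
  ext t
  have hpos : (Matrix.diagonal fun i => (v i : ℝ)).PosSemidef :=
    Matrix.PosSemidef.diagonal fun i => (v i).2
  rw [charFun_multivariateGaussian hpos, charFun_pi]
  simp only [charFun_gaussianReal, ← Complex.exp_sum]
  congr 1
  simp [Matrix.mulVec_diagonal, dotProduct, Finset.sum_div]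
  exact Finset.sum_congr rfl fun i _ => by ring

/-! ### Hilbert-Schmidt norm and simultaneous diagonalization. -/

theorem sum_sq_eq_trace {ι : Type*} [Fintype ι] (X : Matrix ι ι ℝ) :
    ∑ i, ∑ j, X i j ^ 2 = (X * X.transpose).trace := by
  simp [Matrix.trace, Matrix.mul_apply, sq]

theorem sum_sq_conj {ι : Type*} [Fintype ι] [DecidableEq ι] {U : Matrix ι ι ℝ}
    (hU : U.transpose * U = 1) (X : Matrix ι ι ℝ) :
    ∑ i, ∑ j, (U * X * U.transpose) i j ^ 2 = ∑ i, ∑ j, X i j ^ 2 := by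
  rw [sum_sq_eq_trace, sum_sq_eq_trace, Matrix.transpose_mul, Matrix.transpose_mul,
    Matrix.transpose_transpose]
  have : U * X * U.transpose * (U * (X.transpose * U.transpose)) =
      U * (X * X.transpose) * U.transpose := by
    calc _ = U * X * (U.transpose * U) * X.transpose * U.transpose := by simp only [Matrix.mul_assoc]
      _ = _ := by rw [hU]; simp only [Matrix.mul_assoc, Matrix.mul_one]
  rw [this, Matrix.trace_mul_comm, ← Matrix.mul_assoc, hU, Matrix.one_mul]

/-- Orthogonal diagonalization of a real symmetric matrix. -/
theorem exists_orthogonal_diagonal {ι : Type*} [Fintype ι] [DecidableEq ι] {A : Matrix ι ι ℝ}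
    (hA : A.IsHermitian) : ∃ (V : Matrix ι ι ℝ) (a : ι → ℝ), V.transpose * V = 1 ∧
      V * V.transpose = 1 ∧ A = V * Matrix.diagonal a * V.transpose := by
  refine ⟨hA.eigenvectorUnitary, hA.eigenvalues, ?_, ?_, ?_⟩
  · have := Unitary.coe_star_mul_self hA.eigenvectorUnitary
    rwa [Matrix.star_eq_conjTranspose, Matrix.conjTranspose_eq_transpose_of_trivial] at this
  · have := Unitary.coe_mul_star_self hA.eigenvectorUnitary
    rwa [Unitary.coe_star, Matrix.star_eq_conjTranspose, Matrix.conjTranspose_eq_transpose_of_trivial] at this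
  · have := hA.spectral_theorem
    rw [Unitary.conjStarAlgAut_apply, Matrix.star_eq_conjTranspose,
      Matrix.conjTranspose_eq_transpose_of_trivial] at this
    exact this

/-- Simultaneous diagonalization of a symmetric matrix `A ≥ c > 0` and a symmetric matrix `B`. -/
theorem exists_simultaneous_diagonal {ι : Type*} [Fintype ι] [DecidableEq ι] {A B : Matrix ι ι ℝ}
    (hA : A.IsHermitian) (hB : B.IsHermitian) {c : ℝ} (hc : 0 < c)
    (hAc : ∀ x : ι → ℝ, c * (x ⬝ᵥ x) ≤ x ⬝ᵥ A.mulVec x) :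
    ∃ (T : Matrix ι ι ℝ) (v : ι → ℝ), A = T * T.transpose ∧
      B = T * Matrix.diagonal v * T.transpose ∧
      c ^ 2 * ∑ i, (v i - 1) ^ 2 ≤ ∑ i, ∑ j, (B i j - A i j) ^ 2 := by
  obtain ⟨V, a, hV1, hV2, hVA⟩ := exists_orthogonal_diagonal hA
  -- The quadratic form is tested on the eigenvector `V eᵢ`.
  have ha : ∀ i, c ≤ a i := fun i => by
    have h := hAc (V.mulVec (Pi.single i 1))
    have e1 : V.mulVec (Pi.single i 1) ⬝ᵥ V.mulVec (Pi.single i 1) = 1 := by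
      rw [Matrix.dotProduct_mulVec, ← Matrix.mulVec_transpose, Matrix.mulVec_mulVec, hV1]; simp
    have e2 : V.mulVec (Pi.single i 1) ⬝ᵥ A.mulVec (V.mulVec (Pi.single i 1)) = a i := by
      rw [hVA, ← Matrix.mulVec_mulVec, Matrix.mulVec_mulVec (N := V), hV1, Matrix.one_mulVec,
        ← Matrix.mulVec_mulVec, Matrix.dotProduct_mulVec, ← Matrix.mulVec_transpose,
        Matrix.mulVec_mulVec, hV1]
      simp
    rwa [e1, e2, mul_one] at h
  have ha0 : ∀ i, 0 < a i := fun i => hc.trans_le (ha i)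
  have hs0 : ∀ i, √(a i) ≠ 0 := fun i => (Real.sqrt_pos.2 (ha0 i)).ne'
  -- `R` is a square root of `A` in the sense `R Rᵀ = A`, and `S` is its inverse. Diagonalizing `S B
  -- Sᵀ` by an orthogonal `W` gives `T = R W`.
  set R := V * Matrix.diagonal fun i => √(a i) with hR
  set S := Matrix.diagonal (fun i => (√(a i))⁻¹) * V.transpose with hS
  have hSR : S * R = 1 := by
    rw [hS, hR, Matrix.mul_assoc, ← Matrix.mul_assoc V.transpose, hV1, Matrix.one_mul,
      Matrix.diagonal_mul_diagonal]
    simp [hs0]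
  have hRS : R * S = 1 := mul_eq_one_comm.1 hSR
  have hRR : R * R.transpose = A := by
    rw [hR, Matrix.transpose_mul, Matrix.diagonal_transpose, Matrix.mul_assoc,
      ← Matrix.mul_assoc (Matrix.diagonal _), Matrix.diagonal_mul_diagonal, ← Matrix.mul_assoc, hVA]
    simp [Real.mul_self_sqrt (ha0 _).le]
  have hRSt : S.transpose * R.transpose = 1 := by
    rw [← Matrix.transpose_mul, hRS, Matrix.transpose_one]
  have hSRt : R.transpose * S.transpose = 1 := mul_eq_one_comm.1 hRSt
  have hD : (S * B * S.transpose).IsHermitian := by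
    rw [Matrix.IsHermitian, Matrix.conjTranspose_eq_transpose_of_trivial] at hB ⊢
    simp [Matrix.transpose_mul, hB, Matrix.mul_assoc]
  obtain ⟨W, v, hW1, hW2, hWD⟩ := exists_orthogonal_diagonal hD
  refine ⟨R * W, v, ?_, ?_, ?_⟩
  · calc A = R * 1 * R.transpose := by rw [Matrix.mul_one, hRR]
      _ = _ := by rw [← hW2, Matrix.transpose_mul R W]; simp only [Matrix.mul_assoc]
  · calc B = (R * S) * B * (S.transpose * R.transpose) := by
          rw [hRS, hRSt, Matrix.one_mul, Matrix.mul_one]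
      _ = R * (S * B * S.transpose) * R.transpose := by simp only [Matrix.mul_assoc]
      _ = _ := by rw [hWD, Matrix.transpose_mul R W]; simp only [Matrix.mul_assoc]
  · have e1 : ∑ i, (v i - 1) ^ 2 = ∑ i, ∑ j, (Matrix.diagonal v - 1) i j ^ 2 := by
      refine Finset.sum_congr rfl fun i _ => ?_
      rw [Finset.sum_eq_single i]
      · simp
      · intro j _ hj; simp [Matrix.diagonal_apply_ne' _ hj, Matrix.one_apply_ne' hj]
      · simp
    have e2 : W * (Matrix.diagonal v - 1) * W.transpose = S * (B - A) * S.transpose := by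
      rw [Matrix.mul_sub, Matrix.sub_mul, ← hWD, Matrix.mul_one, hW2, Matrix.mul_sub,
        Matrix.sub_mul, ← hRR]
      congr 1
      calc (1 : Matrix ι ι ℝ) = (S * R) * (R.transpose * S.transpose) := by
            rw [hSR, hSRt, Matrix.one_mul]
        _ = _ := by simp only [Matrix.mul_assoc]
    -- In the eigenbasis of `A` the passage to `S (B - A) Sᵀ` scales the entry `(i, j)` by `(aᵢ
    -- aⱼ)^(-1/2)`, at most `c⁻¹`.
    have e3 : ∀ i j, (S * (B - A) * S.transpose) i j =
        (√(a i))⁻¹ * (V.transpose * (B - A) * V) i j * (√(a j))⁻¹ := fun i j => by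
      have : S * (B - A) * S.transpose = Matrix.diagonal (fun i => (√(a i))⁻¹) *
          (V.transpose * (B - A) * V) * Matrix.diagonal (fun i => (√(a i))⁻¹) := by
        rw [hS, Matrix.transpose_mul, Matrix.diagonal_transpose, Matrix.transpose_transpose]
        simp only [Matrix.mul_assoc]
      rw [this, Matrix.mul_diagonal, Matrix.diagonal_mul]
    have e4 := sum_sq_conj (U := V.transpose) (by rwa [Matrix.transpose_transpose]) (B - A)
    rw [Matrix.transpose_transpose] at e4
    rw [e1, ← sum_sq_conj hW1, e2]
    simp only [Matrix.sub_apply] at e4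
    rw [← e4, Finset.mul_sum]
    refine Finset.sum_le_sum fun i _ => ?_
    rw [Finset.mul_sum]
    refine Finset.sum_le_sum fun j _ => ?_
    rw [e3, mul_pow, mul_pow, inv_pow, inv_pow, Real.sq_sqrt (ha0 i).le, Real.sq_sqrt (ha0 j).le]
    have hi : c * (a i)⁻¹ ≤ 1 := by rw [← div_eq_mul_inv, div_le_one (ha0 i)]; exact ha i
    have hj : c * (a j)⁻¹ ≤ 1 := by rw [← div_eq_mul_inv, div_le_one (ha0 j)]; exact ha j
    have hi0 : 0 ≤ c * (a i)⁻¹ := mul_nonneg hc.le (inv_nonneg.2 (ha0 i).le)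
    have hj0 : 0 ≤ c * (a j)⁻¹ := mul_nonneg hc.le (inv_nonneg.2 (ha0 j).le)
    calc _ = (c * (a i)⁻¹) * (c * (a j)⁻¹) * (V.transpose * (B - A) * V) i j ^ 2 := by ring
      _ ≤ 1 * (V.transpose * (B - A) * V) i j ^ 2 :=
        mul_le_mul_of_nonneg_right (mul_le_one₀ hi hj0 hj) (sq_nonneg _)
      _ = _ := one_mul _

/-- Centered Gaussian measures whose covariance matrices are close in the Hilbert-Schmidt norm
are close in total variation, provided that one covariance is bounded away from zero. -/
theorem tvDist_multivariateGaussian_le {ι : Type*} [Fintype ι] [DecidableEq ι]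
    {A B : Matrix ι ι ℝ} (hA : A.IsHermitian) (hB : B.IsHermitian) {c : ℝ} (hc : 0 < c)
    (hAc : ∀ x : ι → ℝ, c * (x ⬝ᵥ x) ≤ x ⬝ᵥ A.mulVec x) {d : ℝ}
    (hd : ∑ i, ∑ j, (B i j - A i j) ^ 2 ≤ d) (hdc : d ≤ c ^ 2 / 2) :
    tvDist (multivariateGaussian 0 A) (multivariateGaussian 0 B) ≤
      ENNReal.ofReal (√(2 * (d / c ^ 2))) := by
  obtain ⟨T, v, hTA, hTB, hv⟩ := exists_simultaneous_diagonal hA hB hc hAc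
  have hv1 : ∑ i, (v i - 1) ^ 2 ≤ d / c ^ 2 := by
    rw [le_div_iff₀ (by positivity), mul_comm]; exact hv.trans hd
  have hv2 : d / c ^ 2 ≤ 1 / 2 := by
    rw [div_le_iff₀ (by positivity)]; linarith
  -- Positive semidefiniteness of `B` is not assumed; it follows from closeness to `A`.
  have hv0 : ∀ i, 0 ≤ v i := fun i => by
    have := (Finset.single_le_sum (f := fun i => (v i - 1) ^ 2) (fun _ _ => sq_nonneg _)
      (Finset.mem_univ i)).trans (hv1.trans hv2)
    nlinarith
  lift v to ι → NNReal using hv0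
  have hdiag : (Matrix.diagonal fun i => (v i : ℝ)).PosSemidef :=
    Matrix.PosSemidef.diagonal fun i => (v i).2
  -- Both measures are images under `T` of product measures, and an image cannot increase total
  -- variation.
  have h1 := map_multivariateGaussian (Matrix.PosSemidef.one (n := ι) (R := ℝ)) T
  have h2 := map_multivariateGaussian hdiag T
  rw [Matrix.mul_one, ← hTA, ← Matrix.diagonal_one] at h1
  have h3 := multivariateGaussian_diagonal (fun _ : ι => 1)
  simp only [NNReal.coe_one] at h3
  rw [h3] at h1
  rw [multivariateGaussian_diagonal] at h2
  rw [← h1, hTB, ← h2]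
  refine (tvDist_map_le (LinearMap.continuous_of_finiteDimensional _).measurable _ _).trans ?_
  refine (tvDist_map_le (by fun_prop) _ _).trans ?_
  refine (tvDist_pi_gaussianReal_le (hv1.trans hv2)).trans ?_
  exact ENNReal.ofReal_le_ofReal (Real.sqrt_le_sqrt (by linarith))

/-! ### Trigonometric sums over an equidistant grid -/

/-- Real part of a geometric sum of roots of unity; the shift only contributes a unimodular factor.
It will be `-q` for centered frequencies and `-s` for row `s` of a matrix. -/
theorem sum_cos_grid {m : ℕ} (hm : 0 < m) (k u : ℤ) :
    ∑ i ∈ Finset.range m, Real.cos (2 * Real.pi * k * ((i : ℝ) + u) / m) =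
      if (m : ℤ) ∣ k then (m : ℝ) else 0 := by
  have hm' : (m : ℝ) ≠ 0 := by positivity
  have hmc : (m : ℂ) ≠ 0 := by exact_mod_cast hm'
  split_ifs with h
  · obtain ⟨j, rfl⟩ := h
    have : ∀ i ∈ Finset.range m,
        Real.cos (2 * Real.pi * ((m * j : ℤ) : ℝ) * ((i : ℝ) + u) / m) = 1 := fun i _ => by
      rw [← Real.cos_int_mul_two_pi (j * (i + u))]
      congr 1; push_cast; field_simp
    rw [Finset.sum_congr rfl this]; simp
  · set ζ : ℂ := Complex.exp (2 * Real.pi * Complex.I / m) with hζ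
    have hprim : IsPrimitiveRoot ζ m := Complex.isPrimitiveRoot_exp m hm.ne'
    have hne : ζ ^ k ≠ 1 := fun h1 => h ((hprim.zpow_eq_one_iff_dvd k).1 h1)
    have hpow : (ζ ^ k) ^ m = 1 := by
      rw [← zpow_natCast, ← zpow_mul, mul_comm, zpow_mul, zpow_natCast, hprim.pow_eq_one, one_zpow]
    have hsum : ∑ i ∈ Finset.range m, (ζ ^ k) ^ i = 0 := by
      rw [geom_sum_eq hne, hpow]; simp
    have hterm : ∀ i : ℕ, Real.cos (2 * Real.pi * k * ((i : ℝ) + u) / m) =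
        (ζ ^ (k * u) * (ζ ^ k) ^ i).re := fun i => by
      rw [← zpow_natCast, ← zpow_mul, hζ, ← Complex.exp_int_mul, ← Complex.exp_int_mul,
        ← Complex.exp_add]
      have : ((k * u : ℤ) : ℂ) * (2 * Real.pi * Complex.I / m) +
          ((k * (i : ℤ) : ℤ) : ℂ) * (2 * Real.pi * Complex.I / m) =
          ((2 * Real.pi * k * ((i : ℝ) + u) / m : ℝ) : ℂ) * Complex.I := by
        push_cast; ring
      rw [this, Complex.exp_ofReal_mul_I_re]
    simp only [hterm]
    rw [← Complex.re_sum, ← Finset.mul_sum, hsum]; simp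

theorem sum_cos_mul_cos_grid {m : ℕ} (hm : 0 < m) (k l u : ℤ) :
    ∑ i ∈ Finset.range m, Real.cos (2 * Real.pi * k * ((i : ℝ) + u) / m) *
        Real.cos (2 * Real.pi * l * ((i : ℝ) + u) / m) =
      ((if (m : ℤ) ∣ k - l then (m : ℝ) else 0) + if (m : ℤ) ∣ k + l then (m : ℝ) else 0) / 2 := by
  rw [← sum_cos_grid hm (k - l) u, ← sum_cos_grid hm (k + l) u, ← Finset.sum_add_distrib,
    Finset.sum_div]
  refine Finset.sum_congr rfl fun i _ => ?_
  have e1 : 2 * Real.pi * ((k - l : ℤ) : ℝ) * ((i : ℝ) + u) / m =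
      2 * Real.pi * k * ((i : ℝ) + u) / m - 2 * Real.pi * l * ((i : ℝ) + u) / m := by
    push_cast; ring
  have e2 : 2 * Real.pi * ((k + l : ℤ) : ℝ) * ((i : ℝ) + u) / m =
      2 * Real.pi * k * ((i : ℝ) + u) / m + 2 * Real.pi * l * ((i : ℝ) + u) / m := by
    push_cast; ring
  rw [e1, e2, Real.cos_sub, Real.cos_add]; ring

theorem sum_range_eq_sum_Icc {E : Type*} [AddCommMonoid E] (q : ℕ) (F : ℤ → E) :
    ∑ i ∈ Finset.range (2 * q + 1), F ((i : ℤ) - q) = ∑ l ∈ Finset.Icc (-q : ℤ) q, F l := by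
  refine Finset.sum_nbij' (fun i : ℕ => (i : ℤ) - q) (fun l : ℤ => (l + q).toNat) ?_ ?_ ?_ ?_ ?_
  all_goals intro a ha; simp only [Finset.mem_range, Finset.mem_Icc] at ha ⊢; try omega

theorem sum_Icc_neg {E : Type*} [AddCommMonoid E] (q : ℕ) (F : ℤ → E) :
    ∑ l ∈ Finset.Icc (-q : ℤ) q, F (-l) = ∑ l ∈ Finset.Icc (-q : ℤ) q, F l := by
  refine Finset.sum_nbij' (fun l => -l) (fun l => -l) ?_ ?_ ?_ ?_ ?_
  all_goals intro a ha; simp only [Finset.mem_Icc] at ha ⊢; try omega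

theorem dvd_iff_eq_of_lt {m : ℕ} {a : ℤ} (h : |a| < m) : (m : ℤ) ∣ a ↔ a = 0 := by
  refine ⟨fun hd => Int.eq_zero_of_abs_lt_dvd hd h, fun h => h ▸ dvd_zero _⟩

/-- Two indices in `[-q, q]` differ by at most `2q`, so congruence modulo `2q + 1` means equality.
-/
theorem sum_Icc_ite_dvd_sub (q : ℕ) (a : ℤ → ℝ) {k : ℤ} (hk : k ∈ Finset.Icc (-q : ℤ) q) :
    ∑ l ∈ Finset.Icc (-q : ℤ) q,
      a l * (if ((2 * q + 1 : ℕ) : ℤ) ∣ l - k then ((2 * q + 1 : ℕ) : ℝ) else 0) =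
      (2 * q + 1 : ℕ) * a k := by
  rw [Finset.sum_eq_single k]
  · simp [mul_comm]
  · intro l hl hlk
    simp only [Finset.mem_Icc] at hl hk
    rw [if_neg, mul_zero]
    rw [dvd_iff_eq_of_lt (by rw [abs_lt]; push_cast; omega)]; omega
  · exact fun h => absurd hk h

/-- Bessel's inequality for real trigonometric polynomials on a grid. -/
theorem sum_sq_trigPoly_le (q : ℕ) (u : ℤ) (a : ℤ → ℝ) :
    ∑ i ∈ Finset.range (2 * q + 1), (∑ l ∈ Finset.Icc (-q : ℤ) q,
        a l * Real.cos (2 * Real.pi * l * ((i : ℝ) + u) / (2 * q + 1 : ℕ))) ^ 2 ≤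
      (2 * q + 1 : ℕ) * ∑ l ∈ Finset.Icc (-q : ℤ) q, a l ^ 2 := by
  set I := Finset.Icc (-q : ℤ) q with hI
  set m := 2 * q + 1 with hm
  have hm0 : 0 < m := by omega
  have e1 : ∑ i ∈ Finset.range m, (∑ l ∈ I,
        a l * Real.cos (2 * Real.pi * l * ((i : ℝ) + u) / m)) ^ 2 =
      ∑ k ∈ I, a k * ∑ l ∈ I, a l * (((if (m : ℤ) ∣ l - k then (m : ℝ) else 0) +
        if (m : ℤ) ∣ l + k then (m : ℝ) else 0) / 2) := by
    simp only [← sum_cos_mul_cos_grid hm0 _ _ u, sq, Finset.sum_mul, Finset.mul_sum]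
    rw [Finset.sum_comm]
    refine Finset.sum_congr rfl fun k _ => ?_
    rw [Finset.sum_comm]
    exact Finset.sum_congr rfl fun l _ => Finset.sum_congr rfl fun i _ => by ring
  have e2 : ∀ k ∈ I, ∑ l ∈ I, a l * (((if (m : ℤ) ∣ l - k then (m : ℝ) else 0) +
        if (m : ℤ) ∣ l + k then (m : ℝ) else 0) / 2) = m * ((a k + a (-k)) / 2) := fun k hk => by
    have hk' : -k ∈ I := by simp only [hI, Finset.mem_Icc] at hk ⊢; omega
    have h1 := sum_Icc_ite_dvd_sub q a hk
    have h2 := sum_Icc_ite_dvd_sub q a hk'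
    simp only [sub_neg_eq_add] at h2
    calc _ = (∑ l ∈ I, a l * (if (m : ℤ) ∣ l - k then (m : ℝ) else 0) +
          ∑ l ∈ I, a l * (if (m : ℤ) ∣ l + k then (m : ℝ) else 0)) / 2 := by
          rw [← Finset.sum_add_distrib, Finset.sum_div]
          exact Finset.sum_congr rfl fun l _ => by ring
      _ = _ := by rw [h1, h2]; ring
  rw [e1]
  have e3 : ∑ k ∈ I, a (-k) ^ 2 = ∑ k ∈ I, a k ^ 2 := sum_Icc_neg q fun k => a k ^ 2
  calc _ = ∑ k ∈ I, a k * (m * ((a k + a (-k)) / 2)) :=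
        Finset.sum_congr rfl fun k hk => by rw [e2 k hk]
    -- Frequencies `k` and `-k` give the same cosine, hence the cross term; after reflecting the
    -- index the weights `3/4` and `1/4` add up to one.
    _ ≤ ∑ k ∈ I, (m : ℝ) * (3 / 4 * a k ^ 2 + 1 / 4 * a (-k) ^ 2) := by
        refine Finset.sum_le_sum fun k _ => ?_
        have : a k * ((a k + a (-k)) / 2) ≤ 3 / 4 * a k ^ 2 + 1 / 4 * a (-k) ^ 2 := by
          nlinarith [sq_nonneg (a k - a (-k))]
        calc a k * (m * ((a k + a (-k)) / 2)) = m * (a k * ((a k + a (-k)) / 2)) := by ring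
          _ ≤ _ := mul_le_mul_of_nonneg_left this (by positivity)
    _ = _ := by
        rw [← Finset.mul_sum, Finset.sum_add_distrib, ← Finset.mul_sum, ← Finset.mul_sum, e3]; ring

/-! ### Circulant approximation of a Toeplitz matrix -/

/-- The truncated cosine series `∑_{|j| ≤ q} γ(j) cos(j ω)`. -/
def cosSum (q : ℕ) (γ : ℤ → ℝ) (ω : ℝ) : ℝ :=
  ∑ j ∈ Finset.Icc (-q : ℤ) q, γ j * Real.cos (j * ω)

/-- The `m`-periodic covariance function with spectrum `cosSum q γ` on the grid, `m = 2q + 1`. -/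
def circulantCov (q : ℕ) (γ : ℤ → ℝ) (k : ℤ) : ℝ :=
  ((2 * q + 1 : ℕ) : ℝ)⁻¹ * ∑ l ∈ Finset.Icc (-q : ℤ) q,
    cosSum q γ (2 * Real.pi * l / (2 * q + 1 : ℕ)) *
      Real.cos (2 * Real.pi * l / (2 * q + 1 : ℕ) * k)

theorem circulantCov_neg (q : ℕ) (γ : ℤ → ℝ) (k : ℤ) :
    circulantCov q γ (-k) = circulantCov q γ k := by
  simp [circulantCov, Real.cos_neg]

/-- Aliasing: orthogonality of cosines on the grid retains only the lags `j ≡ ±k` modulo `2q + 1`.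
-/
theorem circulantCov_eq_sum (q : ℕ) (γ : ℤ → ℝ) (k : ℤ) :
    circulantCov q γ k = ((2 * q + 1 : ℕ) : ℝ)⁻¹ * ∑ j ∈ Finset.Icc (-q : ℤ) q, γ j *
      (((if ((2 * q + 1 : ℕ) : ℤ) ∣ j - k then ((2 * q + 1 : ℕ) : ℝ) else 0) +
        if ((2 * q + 1 : ℕ) : ℤ) ∣ j + k then ((2 * q + 1 : ℕ) : ℝ) else 0) / 2) := by
  rw [circulantCov]
  congr 1
  simp only [← sum_cos_mul_cos_grid (Nat.succ_pos (2 * q)) _ _ (-q : ℤ)]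
  rw [← sum_range_eq_sum_Icc]
  simp only [cosSum, Finset.sum_mul, Finset.mul_sum]
  rw [Finset.sum_comm]
  refine Finset.sum_congr rfl fun j _ => Finset.sum_congr rfl fun i _ => ?_
  rw [mul_assoc]
  congr 3
  · push_cast; ring
  · push_cast; ring

theorem circulantCov_of_mem (q : ℕ) {γ : ℤ → ℝ} (hγ : ∀ k, γ (-k) = γ k) {k : ℤ}
    (hk : k ∈ Finset.Icc (-q : ℤ) q) : circulantCov q γ k = γ k := by
  have hk' : -k ∈ Finset.Icc (-q : ℤ) q := by simp only [Finset.mem_Icc] at hk ⊢; omega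
  have h1 := sum_Icc_ite_dvd_sub q γ hk
  have h2 := sum_Icc_ite_dvd_sub q γ hk'
  simp only [sub_neg_eq_add] at h2
  have hm : ((2 * q + 1 : ℕ) : ℝ) ≠ 0 := by positivity
  rw [circulantCov_eq_sum]
  simp only [mul_div_assoc', mul_add, ← Finset.sum_div, Finset.sum_add_distrib]
  rw [h1, h2, hγ]
  field_simp
  ring

theorem circulantCov_add_period (q : ℕ) (γ : ℤ → ℝ) (k : ℤ) :
    circulantCov q γ (k + (2 * q + 1 : ℕ)) = circulantCov q γ k := by
  have hm : ((2 * q + 1 : ℕ) : ℝ) ≠ 0 := by positivity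
  rw [circulantCov, circulantCov]
  congr 1
  refine Finset.sum_congr rfl fun l _ => ?_
  congr 1
  rw [← Real.cos_add_int_mul_two_pi (_ * (k : ℝ)) l]
  congr 1
  rw [Int.cast_add, Int.cast_natCast]
  field_simp

/-- Wrap-around: shifting by one period brings `k` into `[-q, 0]`. -/
theorem circulantCov_of_lt (q : ℕ) {γ : ℤ → ℝ} (hγ : ∀ k, γ (-k) = γ k) {k : ℤ} (hk : q < k)
    (hk' : k ≤ (2 * q + 1 : ℕ)) : circulantCov q γ k = γ ((2 * q + 1 : ℕ) - k) := by
  have h := circulantCov_add_period q γ (k - (2 * q + 1 : ℕ))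
  rw [sub_add_cancel] at h
  rw [h, circulantCov_of_mem q hγ, ← hγ, neg_sub]
  simp only [Finset.mem_Icc]; push_cast at hk' ⊢; omega

/-- Summation along the diagonals of a symmetric Toeplitz matrix. -/
theorem sum_sum_toeplitz (F : ℤ → ℝ) (hF : ∀ k, F (-k) = F k) (n : ℕ) :
    ∑ s ∈ Finset.range n, ∑ t ∈ Finset.range n, F ((t : ℤ) - s) + n * F 0 =
      2 * ∑ k ∈ Finset.range n, ((n : ℝ) - k) * F k := by
  -- Each step adds a border row, a border column and one diagonal entry. The term `n F(0)`
  -- compensates for the diagonal being counted twice on the right.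
  induction n with
  | zero => simp
  | succ n ih =>
    have e1 : ∑ t ∈ Finset.range n, F ((t : ℤ) - n) = ∑ k ∈ Finset.range n, F ((k : ℤ) + 1) := by
      rw [← Finset.sum_range_reflect]
      refine Finset.sum_congr rfl fun k hk => ?_
      rw [← hF]; congr 1
      have := Finset.mem_range.1 hk
      omega
    have e2 : ∑ s ∈ Finset.range n, F ((n : ℤ) - s) = ∑ t ∈ Finset.range n, F ((t : ℤ) - n) :=
      Finset.sum_congr rfl fun s _ => by rw [← hF, neg_sub]
    have e3 : ∑ k ∈ Finset.range (n + 1), F k = ∑ k ∈ Finset.range n, F ((k : ℤ) + 1) + F 0 := by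
      rw [Finset.sum_range_succ']; simp
    have e4 : ∑ k ∈ Finset.range (n + 1), (((n + 1 : ℕ) : ℝ) - k) * F k =
        ∑ k ∈ Finset.range n, ((n : ℝ) - k) * F k + ∑ k ∈ Finset.range (n + 1), F k := by
      have : ∑ k ∈ Finset.range n, ((n : ℝ) - k) * F k =
          ∑ k ∈ Finset.range (n + 1), ((n : ℝ) - k) * F k := by
        rw [Finset.sum_range_succ]; simp
      rw [this, ← Finset.sum_add_distrib]
      exact Finset.sum_congr rfl fun k _ => by push_cast; ring
    rw [e4, e3, Finset.sum_range_succ]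
    simp only [Finset.sum_range_succ, Finset.sum_add_distrib]
    rw [e2, e1, sub_self]
    push_cast
    linarith

/-- Since `1 - 2β ≤ 0`, the factor `x^(1-2β)` is largest at `x = ρ`. This trades the surplus of the
Sobolev weight over `|k|` for a rate. -/
theorem mul_sq_le_rpow_mul {β ρ x y : ℝ} (hβ : 1 / 2 ≤ β) (hρ : 0 < ρ) (hx : ρ ≤ x) :
    x * y ^ 2 ≤ ρ ^ (1 - 2 * β) * (x ^ (2 * β) * y ^ 2) := by
  have hx0 : 0 < x := hρ.trans_le hx
  have h1 : x ^ (1 - 2 * β) ≤ ρ ^ (1 - 2 * β) :=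
    Real.rpow_le_rpow_of_nonpos hρ hx (by linarith)
  have h2 : x = x ^ (1 - 2 * β) * x ^ (2 * β) := by
    rw [← Real.rpow_add hx0]; simp
  calc x * y ^ 2 = x ^ (1 - 2 * β) * (x ^ (2 * β) * y ^ 2) := by rw [← mul_assoc, ← h2]
    _ ≤ _ := mul_le_mul_of_nonneg_right h1 (by positivity)

/-- A Toeplitz matrix of size `n = m - r` differs from a section of the circulant matrix of size
`m = 2q + 1` by a small amount in the Hilbert-Schmidt norm. -/
theorem sum_sq_sub_circulantCov_le {q n r : ℕ} (hnr : n + r = 2 * q + 1) {γ : ℤ → ℝ}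
    (hγ : ∀ k, γ (-k) = γ k) {β W ρ : ℝ} (hβ : 1 / 2 ≤ β)
    (hsum : Summable fun k : ℤ => |(k : ℝ)| ^ (2 * β) * γ k ^ 2)
    (hW : ∑' k : ℤ, |(k : ℝ)| ^ (2 * β) * γ k ^ 2 ≤ W)
    (hρ : 0 < ρ) (hρq : ρ ≤ q + 1) (hρr : ρ ≤ r + 1) :
    ∑ s ∈ Finset.range n, ∑ t ∈ Finset.range n,
      (γ ((t : ℤ) - s) - circulantCov q γ ((t : ℤ) - s)) ^ 2 ≤ 8 * W * ρ ^ (1 - 2 * β) := by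
  set w : ℤ → ℝ := fun k => |(k : ℝ)| ^ (2 * β) * γ k ^ 2 with hw
  have hw0 : ∀ k, 0 ≤ w k := fun k => by positivity
  have hterm : ∀ k ∈ Finset.range n, ((n : ℝ) - k) * (γ k - circulantCov q γ k) ^ 2 ≤
      2 * ρ ^ (1 - 2 * β) * (w k + w ((2 * q + 1 : ℕ) - k)) := fun k hk => by
    have hkn := Finset.mem_range.1 hk
    rcases le_or_gt k q with h | h
    · rw [circulantCov_of_mem q hγ (by simp only [Finset.mem_Icc]; omega), sub_self]
      simp only [ne_eq, OfNat.ofNat_ne_zero, not_false_eq_true, zero_pow, mul_zero]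
      have := hw0 k; have := hw0 ((2 * q + 1 : ℕ) - k); positivity
    -- For `q < k < n` the multiplicity `n - k` is at most `k` and at most `m - k`, so it is
    -- absorbed by either lag. Both lags are at least `ρ`, because `k ≥ q + 1` and `m - k ≥ r + 1`.
    · rw [circulantCov_of_lt q hγ (by omega) (by omega)]
      have hx : ((((2 * q + 1 : ℕ) : ℤ) - k : ℤ) : ℝ) = (2 * q + 1 : ℕ) - (k : ℝ) := by push_cast; ring
      have hnr' : (n : ℝ) + r = (2 * q + 1 : ℕ) := by exact_mod_cast hnr
      have hk1 : (k : ℝ) + 1 ≤ n := by exact_mod_cast hkn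
      have hqk : (q : ℝ) + 1 ≤ k := by exact_mod_cast h
      have hr0 : (0 : ℝ) ≤ r := by positivity
      have hmr : ((2 * q + 1 : ℕ) : ℝ) = 2 * q + 1 := by push_cast; ring
      have h1 := mul_sq_le_rpow_mul (x := k) (y := γ k) hβ hρ (by linarith)
      have h2 := mul_sq_le_rpow_mul (x := (2 * q + 1 : ℕ) - (k : ℝ))
        (y := γ ((2 * q + 1 : ℕ) - k)) hβ hρ (by linarith)
      have hw1 : w k = (k : ℝ) ^ (2 * β) * γ k ^ 2 := by
        simp only [hw, Int.cast_natCast, Nat.abs_cast]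
      have hw2 : w ((2 * q + 1 : ℕ) - k) =
          ((2 * q + 1 : ℕ) - (k : ℝ)) ^ (2 * β) * γ ((2 * q + 1 : ℕ) - k) ^ 2 := by
        simp only [hw]; rw [hx, abs_of_nonneg (by linarith)]
      rw [← hw1] at h1
      rw [← hw2] at h2
      have h3 : (γ k - γ ((2 * q + 1 : ℕ) - k)) ^ 2 ≤
          2 * γ k ^ 2 + 2 * γ ((2 * q + 1 : ℕ) - k) ^ 2 := by
        nlinarith [sq_nonneg (γ k + γ ((2 * q + 1 : ℕ) - k))]
      have h4 : ((n : ℝ) - k) * γ k ^ 2 ≤ k * γ k ^ 2 :=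
        mul_le_mul_of_nonneg_right (by linarith) (sq_nonneg _)
      have h5 : ((n : ℝ) - k) * γ ((2 * q + 1 : ℕ) - k) ^ 2 ≤
          ((2 * q + 1 : ℕ) - (k : ℝ)) * γ ((2 * q + 1 : ℕ) - k) ^ 2 :=
        mul_le_mul_of_nonneg_right (by linarith) (sq_nonneg _)
      have h6 := mul_le_mul_of_nonneg_left h3 (show (0 : ℝ) ≤ n - k by linarith)
      linarith
  have hsum1 : ∑ k ∈ Finset.range n, w k ≤ W := by
    have := hsum.sum_le_tsum ((Finset.range n).map Nat.castEmbedding) (fun k _ => hw0 k)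
    rw [Finset.sum_map] at this
    exact this.trans hW
  have hsum2 : ∑ k ∈ Finset.range n, w ((2 * q + 1 : ℕ) - k) ≤ W := by
    have := hsum.sum_le_tsum ((Finset.range n).image fun k : ℕ => ((2 * q + 1 : ℕ) : ℤ) - k)
      (fun k _ => hw0 k)
    rw [Finset.sum_image (fun a _ b _ h => by simpa using h)] at this
    exact this.trans hW
  have hT := sum_sum_toeplitz (fun k => (γ k - circulantCov q γ k) ^ 2)
    (fun k => by simp only [hγ, circulantCov_neg]) n
  have h0 : 0 ≤ (n : ℝ) * (γ 0 - circulantCov q γ 0) ^ 2 := by positivity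
  have hB := Finset.sum_le_sum hterm
  rw [← Finset.mul_sum, Finset.sum_add_distrib] at hB
  have hp : 0 ≤ 2 * ρ ^ (1 - 2 * β) := by positivity
  have hB2 := mul_le_mul_of_nonneg_left (add_le_add hsum1 hsum2) hp
  linarith

/-! ### Fourier coefficients of a spectral density -/

theorem neg_pi_le_pi : -Real.pi ≤ Real.pi := by linarith [Real.pi_pos]

theorem memLp_Ioc_of_Icc {f : ℝ → ℝ}
    (hf : MemLp f 2 (volume.restrict (Set.Icc (-Real.pi) Real.pi))) :
    MemLp f 2 (volume.restrict (Set.Ioc (-Real.pi) Real.pi)) :=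
  hf.mono_measure (Measure.restrict_mono_set _ Set.Ioc_subset_Icc_self)

theorem intervalIntegrable_of_memLp {f : ℝ → ℝ}
    (hf : MemLp f 2 (volume.restrict (Set.Ioc (-Real.pi) Real.pi))) :
    IntervalIntegrable f volume (-Real.pi) Real.pi := by
  rw [intervalIntegrable_iff_integrableOn_Ioc_of_le neg_pi_le_pi]
  exact hf.integrable one_le_two

theorem intervalIntegrable_sq_of_memLp {f : ℝ → ℝ}
    (hf : MemLp f 2 (volume.restrict (Set.Ioc (-Real.pi) Real.pi))) :
    IntervalIntegrable (fun ω => f ω ^ 2) volume (-Real.pi) Real.pi := by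
  rw [intervalIntegrable_iff_integrableOn_Ioc_of_le neg_pi_le_pi]
  exact hf.integrable_sq

theorem autocov_eq_integral {f : ℝ → ℝ}
    (hf : IntervalIntegrable f volume (-Real.pi) Real.pi) (k : ℤ) :
    autocov f k = ∫ ω in (-Real.pi)..Real.pi, Real.cos (k * ω) * f ω := by
  have hfint : IntervalIntegrable
      (fun ω : ℝ => Complex.exp (Complex.I * (k : ℂ) * (ω : ℂ)) * (f ω : ℂ)) volume
      (-Real.pi) Real.pi :=
    IntervalIntegrable.continuousOn_mul (f := fun ω => (f ω : ℂ)) ⟨hf.1.ofReal, hf.2.ofReal⟩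
      (by fun_prop)
  have h := intervalIntegral.intervalIntegral_re hfint
  rw [autocov, fourierCoef, ← RCLike.re_eq_complex_re, ← h]
  refine intervalIntegral.integral_congr fun ω _ => ?_
  have : Complex.I * (k : ℂ) * (ω : ℂ) = ((k * ω : ℝ) : ℂ) * Complex.I := by push_cast; ring
  simp only [this, RCLike.re_eq_complex_re, Complex.re_mul_ofReal, Complex.exp_ofReal_mul_I_re]

theorem autocov_neg {f : ℝ → ℝ} (hf : IntervalIntegrable f volume (-Real.pi) Real.pi) (k : ℤ) :
    autocov f (-k) = autocov f k := by
  simp [autocov_eq_integral hf]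

/-- Parseval's identity. -/
theorem hasSum_autocov_sq {f : ℝ → ℝ}
    (hf : MemLp f 2 (volume.restrict (Set.Ioc (-Real.pi) Real.pi)))
    (heven : ∀ ω ∈ Set.Icc (-Real.pi) Real.pi, f (-ω) = f ω) :
    HasSum (fun k => autocov f k ^ 2) (2 * Real.pi * ∫ ω in (-Real.pi)..Real.pi, f ω ^ 2) := by
  have hlt : -Real.pi < Real.pi := by linarith [Real.pi_pos]
  have hpi := Real.pi_pos.ne'
  have h := hasSum_sq_fourierCoeffOn hlt hf.ofReal
  -- `fourierCoeffOn` is normalized by `1/(2π)` and uses the conjugate exponential, hence the factor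
  -- and the sign of `k`.
  have hcoef : ∀ k : ℤ, fourierCoeffOn hlt (fun ω => (f ω : ℂ)) k =
      ((2 * Real.pi)⁻¹ : ℝ) * fourierCoef f (-k) := fun k => by
    rw [fourierCoeffOn_eq_integral, fourierCoef, Complex.real_smul]
    congr 1
    · congr 1; rw [one_div]; congr 1; ring
    · refine intervalIntegral.integral_congr fun ω _ => ?_
      simp only [fourier_coe_apply, smul_eq_mul]
      congr 2
      push_cast
      have : (Real.pi : ℂ) ≠ 0 := by exact_mod_cast hpi
      field_simp
      ring
  have hnorm : ∀ k : ℤ, ‖fourierCoeffOn hlt (fun ω => (f ω : ℂ)) k‖ ^ 2 =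
      ((2 * Real.pi) ^ 2)⁻¹ * autocov f k ^ 2 := fun k => by
    rw [hcoef, norm_mul, ← coe_autocov heven, autocov_neg (intervalIntegrable_of_memLp hf),
      Complex.norm_real, Complex.norm_real, mul_pow]
    simp only [Real.norm_eq_abs, sq_abs, inv_pow]
  have h2 := h.mul_left ((2 * Real.pi) ^ 2)
  have e : ∀ k : ℤ, (2 * Real.pi) ^ 2 * ‖fourierCoeffOn hlt (fun ω => (f ω : ℂ)) k‖ ^ 2 =
      autocov f k ^ 2 := fun k => by rw [hnorm]; field_simp
  have e' : (2 * Real.pi) ^ 2 * ((Real.pi - -Real.pi)⁻¹ • ∫ ω in (-Real.pi)..Real.pi,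
      ‖(f ω : ℂ)‖ ^ 2) = 2 * Real.pi * ∫ ω in (-Real.pi)..Real.pi, f ω ^ 2 := by
    simp only [Complex.norm_real, Real.norm_eq_abs, sq_abs, smul_eq_mul]
    have : Real.pi - -Real.pi = 2 * Real.pi := by ring
    rw [this]; field_simp
  have h3 : HasSum (fun k : ℤ => (2 * Real.pi) ^ 2 *
      ‖fourierCoeffOn hlt (fun ω => (f ω : ℂ)) k‖ ^ 2)
      ((2 * Real.pi) ^ 2 * ((Real.pi - -Real.pi)⁻¹ • ∫ ω in (-Real.pi)..Real.pi,
      ‖(f ω : ℂ)‖ ^ 2)) := h2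
  simp only [e] at h3
  rwa [e'] at h3

theorem integral_cos_int_mul (k : ℤ) :
    ∫ ω in (-Real.pi)..Real.pi, Real.cos (k * ω) = if k = 0 then 2 * Real.pi else 0 := by
  split_ifs with h
  · subst h; simp; ring
  · have hk : (k : ℝ) ≠ 0 := by exact_mod_cast h
    rw [intervalIntegral.integral_comp_mul_left (fun x => Real.cos x) hk, integral_cos]
    simp [Real.sin_int_mul_pi]

theorem continuous_cosSum (q : ℕ) (γ : ℤ → ℝ) : Continuous (cosSum q γ) := by
  unfold cosSum; fun_prop

theorem integral_cos_mul_cosSum (q : ℕ) {γ : ℤ → ℝ} (hγ : ∀ k, γ (-k) = γ k) {k : ℤ}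
    (hk : k ∈ Finset.Icc (-q : ℤ) q) :
    ∫ ω in (-Real.pi)..Real.pi, Real.cos (k * ω) * cosSum q γ ω = 2 * Real.pi * γ k := by
  have hk' : -k ∈ Finset.Icc (-q : ℤ) q := by simp only [Finset.mem_Icc] at hk ⊢; omega
  have e1 : ∀ ω : ℝ, Real.cos (k * ω) * cosSum q γ ω = ∑ j ∈ Finset.Icc (-q : ℤ) q,
      γ j / 2 * (Real.cos ((j - k : ℤ) * ω) + Real.cos ((j + k : ℤ) * ω)) := fun ω => by
    rw [cosSum, Finset.mul_sum]
    refine Finset.sum_congr rfl fun j _ => ?_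
    have h1 : ((j - k : ℤ) : ℝ) * ω = j * ω - k * ω := by push_cast; ring
    have h2 : ((j + k : ℤ) : ℝ) * ω = j * ω + k * ω := by push_cast; ring
    rw [h1, h2, Real.cos_sub, Real.cos_add]; ring
  simp only [e1]
  rw [intervalIntegral.integral_finsetSum fun j _ => Continuous.intervalIntegrable (by fun_prop) _ _]
  -- For `k = 0` both indicators hold at `j = 0` and both count, so no separate case arises.
  have e2 : ∀ j : ℤ, ∫ ω in (-Real.pi)..Real.pi,
      γ j / 2 * (Real.cos ((j - k : ℤ) * ω) + Real.cos ((j + k : ℤ) * ω)) =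
      (if j = k then Real.pi * γ j else 0) + if j = -k then Real.pi * γ j else 0 := fun j => by
    rw [intervalIntegral.integral_const_mul, intervalIntegral.integral_add
      (Continuous.intervalIntegrable (by fun_prop) _ _)
      (Continuous.intervalIntegrable (by fun_prop) _ _), integral_cos_int_mul, integral_cos_int_mul]
    simp only [sub_eq_zero, add_eq_zero_iff_eq_neg]
    split_ifs <;> ring
  simp only [e2]
  rw [Finset.sum_add_distrib, Finset.sum_ite_eq' _ k, Finset.sum_ite_eq' _ (-k), if_pos hk,
    if_pos hk', hγ]
  ring

/-- The squared `L₂` distance of `f` to its truncated Fourier series. -/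
theorem integral_sq_sub_cosSum {f : ℝ → ℝ}
    (hf : MemLp f 2 (volume.restrict (Set.Ioc (-Real.pi) Real.pi))) (q : ℕ) :
    2 * Real.pi * ∫ ω in (-Real.pi)..Real.pi,
        (f ω - (2 * Real.pi)⁻¹ * cosSum q (autocov f) ω) ^ 2 =
      2 * Real.pi * (∫ ω in (-Real.pi)..Real.pi, f ω ^ 2) -
        ∑ k ∈ Finset.Icc (-q : ℤ) q, autocov f k ^ 2 := by
  have hfint := intervalIntegrable_of_memLp hf
  have hcont := continuous_cosSum q (autocov f)
  have i1 := intervalIntegrable_sq_of_memLp hf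
  have i2 : IntervalIntegrable (fun ω => cosSum q (autocov f) ω * f ω) volume
    (-Real.pi) Real.pi := hfint.continuousOn_mul hcont.continuousOn
  have i3 : IntervalIntegrable (fun ω => cosSum q (autocov f) ω ^ 2) volume
    (-Real.pi) Real.pi := (hcont.pow 2).intervalIntegrable _ _
  have hpi := Real.pi_pos.ne'
  have e2 : ∫ ω in (-Real.pi)..Real.pi, cosSum q (autocov f) ω * f ω =
      ∑ k ∈ Finset.Icc (-q : ℤ) q, autocov f k ^ 2 := by
    simp only [cosSum, Finset.sum_mul]
    rw [intervalIntegral.integral_finsetSum fun j _ =>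
      hfint.continuousOn_mul (Continuous.continuousOn (by fun_prop))]
    refine Finset.sum_congr rfl fun k _ => ?_
    simp only [mul_assoc]
    rw [intervalIntegral.integral_const_mul, ← autocov_eq_integral hfint, sq]
  have e3 : ∫ ω in (-Real.pi)..Real.pi, cosSum q (autocov f) ω ^ 2 =
      2 * Real.pi * ∑ k ∈ Finset.Icc (-q : ℤ) q, autocov f k ^ 2 := by
    have : ∀ ω, cosSum q (autocov f) ω ^ 2 = ∑ k ∈ Finset.Icc (-q : ℤ) q,
        autocov f k * (Real.cos (k * ω) * cosSum q (autocov f) ω) := fun ω => by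
      rw [sq]; nth_rewrite 1 [cosSum]; rw [Finset.sum_mul]
      exact Finset.sum_congr rfl fun k _ => by ring
    simp only [this]
    rw [intervalIntegral.integral_finsetSum fun j _ =>
      Continuous.intervalIntegrable (by fun_prop) _ _, Finset.mul_sum]
    refine Finset.sum_congr rfl fun k hk => ?_
    rw [intervalIntegral.integral_const_mul, integral_cos_mul_cosSum q (autocov_neg hfint) hk]
    ring
  have e4 : ∀ ω, (f ω - (2 * Real.pi)⁻¹ * cosSum q (autocov f) ω) ^ 2 =
      f ω ^ 2 - Real.pi⁻¹ * (cosSum q (autocov f) ω * f ω) +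
        ((2 * Real.pi) ^ 2)⁻¹ * cosSum q (autocov f) ω ^ 2 := fun ω => by
    field_simp; ring
  simp only [e4]
  rw [intervalIntegral.integral_add (i1.sub (i2.const_mul _)) (i3.const_mul _),
    intervalIntegral.integral_sub i1 (i2.const_mul _), intervalIntegral.integral_const_mul,
    intervalIntegral.integral_const_mul, e2, e3]
  field_simp
  ring

/-- The tail of the Fourier series under a Sobolev condition. -/
theorem integral_sq_sub_cosSum_le {f : ℝ → ℝ}
    (hf : MemLp f 2 (volume.restrict (Set.Ioc (-Real.pi) Real.pi)))
    (heven : ∀ ω ∈ Set.Icc (-Real.pi) Real.pi, f (-ω) = f ω) (q : ℕ) {β W : ℝ} (hβ : 0 ≤ β)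
    (hsum : Summable fun k : ℤ => |(k : ℝ)| ^ (2 * β) * autocov f k ^ 2)
    (hW : ∑' k : ℤ, |(k : ℝ)| ^ (2 * β) * autocov f k ^ 2 ≤ W) :
    2 * Real.pi * ∫ ω in (-Real.pi)..Real.pi,
        (f ω - (2 * Real.pi)⁻¹ * cosSum q (autocov f) ω) ^ 2 ≤
      ((q : ℝ) + 1) ^ (-(2 * β)) * W := by
  have hP := hasSum_autocov_sq hf heven
  rw [integral_sq_sub_cosSum hf, ← hP.tsum_eq]
  have h1 := hP.summable.sum_add_tsum_compl (s := Finset.Icc (-q : ℤ) q)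
  have hq : (0 : ℝ) < (q : ℝ) + 1 := by positivity
  have hw0 : ∀ k : ℤ, 0 ≤ |(k : ℝ)| ^ (2 * β) * autocov f k ^ 2 := fun k => by positivity
  -- By Parseval only `|k| ≥ q + 1` remains, where `1 ≤ (|k| / (q + 1))^(2β)`.
  have h2 : ∑' k : ↑((↑(Finset.Icc (-q : ℤ) q) : Set ℤ)ᶜ), autocov f k ^ 2 ≤
      ∑' k : ↑((↑(Finset.Icc (-q : ℤ) q) : Set ℤ)ᶜ),
        ((q : ℝ) + 1) ^ (-(2 * β)) * (|((k : ℤ) : ℝ)| ^ (2 * β) * autocov f k ^ 2) := by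
    refine Summable.tsum_le_tsum (fun k => ?_) (hP.summable.subtype _)
      ((hsum.subtype _).mul_left _)
    have hk : (q : ℝ) + 1 ≤ |((k : ℤ) : ℝ)| := by
      have := k.2
      simp only [Finset.coe_Icc, Set.mem_compl_iff, Set.mem_Icc, not_and, not_le] at this
      have h3 : (q : ℤ) + 1 ≤ |(k : ℤ)| := by
        rcases abs_cases (k : ℤ) with ⟨h, _⟩ | ⟨h, _⟩ <;> omega
      exact_mod_cast h3
    rw [← mul_assoc]
    refine le_mul_of_one_le_left (sq_nonneg _) ?_
    rw [Real.rpow_neg hq.le, inv_mul_eq_div, one_le_div (by positivity)]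
    exact Real.rpow_le_rpow hq.le hk (by linarith)
  have h3 : ∑' k : ↑((↑(Finset.Icc (-q : ℤ) q) : Set ℤ)ᶜ),
      |((k : ℤ) : ℝ)| ^ (2 * β) * autocov f k ^ 2 ≤ W :=
    (Summable.tsum_subtype_le _ _ hw0 hsum).trans hW
  rw [tsum_mul_left] at h2
  have h4 := mul_le_mul_of_nonneg_left h3 (Real.rpow_nonneg hq.le (-(2 * β)))
  linarith

/-! ### Local averages -/

/-- The left end of the `i`-th of `m` cells of equal length of `[-π, π]`. -/
def cellEdge (m i : ℕ) : ℝ := 2 * Real.pi * ((i : ℝ) / m) - Real.pi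

/-- The average of `g` over the `i`-th cell. -/
def cellAverage (m : ℕ) (g : ℝ → ℝ) (i : ℕ) : ℝ :=
  m / (2 * Real.pi) * ∫ ω in (cellEdge m i)..(cellEdge m (i + 1)), g ω

theorem localAverage_eq_cellAverage (m : ℕ) (f : ℝ → ℝ) (j : Fin m) :
    localAverage m f j = cellAverage m f j := by
  have hpi := Real.pi_pos
  rw [localAverage, intervalIntegral.integral_comp_mul_sub f (by positivity), smul_eq_mul,
    cellAverage, cellEdge, cellEdge]
  push_cast
  ring

theorem cellEdge_zero (m : ℕ) : cellEdge m 0 = -Real.pi := by simp [cellEdge]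

theorem cellEdge_self {m : ℕ} (hm : 0 < m) : cellEdge m m = Real.pi := by
  have : (m : ℝ) ≠ 0 := by positivity
  rw [cellEdge, div_self this]; ring

theorem cellEdge_mono (m : ℕ) : Monotone (cellEdge m) := fun i j h => by
  have : (i : ℝ) ≤ j := by exact_mod_cast h
  have hpi := Real.pi_pos
  unfold cellEdge
  gcongr

theorem cellEdge_succ_sub (m i : ℕ) : cellEdge m (i + 1) - cellEdge m i = 2 * Real.pi / m := by
  unfold cellEdge; push_cast; ring

theorem cell_subset {m i : ℕ} (hi : i < m) :
    Set.Icc (cellEdge m i) (cellEdge m (i + 1)) ⊆ Set.Icc (-Real.pi) Real.pi := by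
  rw [← cellEdge_zero m, ← cellEdge_self (by omega : 0 < m)]
  exact Set.Icc_subset_Icc (cellEdge_mono m (Nat.zero_le i)) (cellEdge_mono m hi)

theorem intervalIntegrable_cell {m i : ℕ} (hi : i < m) {g : ℝ → ℝ}
    (hg : IntervalIntegrable g volume (-Real.pi) Real.pi) :
    IntervalIntegrable g volume (cellEdge m i) (cellEdge m (i + 1)) := by
  refine hg.mono_set ?_
  rw [Set.uIcc_of_le neg_pi_le_pi, Set.uIcc_of_le (cellEdge_mono m (Nat.le_succ i))]
  exact cell_subset hi

theorem sum_integral_cell {m : ℕ} (hm : 0 < m) {g : ℝ → ℝ}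
    (hg : IntervalIntegrable g volume (-Real.pi) Real.pi) :
    ∑ i ∈ Finset.range m, ∫ ω in (cellEdge m i)..(cellEdge m (i + 1)), g ω =
      ∫ ω in (-Real.pi)..Real.pi, g ω := by
  rw [intervalIntegral.sum_integral_adjacent_intervals fun i hi => intervalIntegrable_cell hi hg,
    cellEdge_zero, cellEdge_self hm]

/-- Cauchy-Schwarz, from `∫ (g - c)² ≥ 0` with `c` the mean of `g`. -/
theorem sq_integral_le {a b : ℝ} (hab : a < b) {g : ℝ → ℝ} (hg : IntervalIntegrable g volume a b)
    (hg2 : IntervalIntegrable (fun x => g x ^ 2) volume a b) :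
    (∫ x in a..b, g x) ^ 2 ≤ (b - a) * ∫ x in a..b, g x ^ 2 := by
  set c := (∫ x in a..b, g x) / (b - a) with hc
  have hba : 0 < b - a := sub_pos.2 hab
  have h0 : 0 ≤ ∫ x in a..b, (g x - c) ^ 2 :=
    intervalIntegral.integral_nonneg hab.le fun x _ => sq_nonneg _
  have e : ∀ x, (g x - c) ^ 2 = g x ^ 2 - 2 * c * g x + c ^ 2 := fun x => by ring
  simp only [e] at h0
  rw [intervalIntegral.integral_add (hg2.sub (hg.const_mul _)) intervalIntegrable_const,
    intervalIntegral.integral_sub hg2 (hg.const_mul _), intervalIntegral.integral_const_mul,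
    intervalIntegral.integral_const, smul_eq_mul] at h0
  have h1 : c * (b - a) = ∫ x in a..b, g x := div_mul_cancel₀ _ hba.ne'
  have h2 := mul_nonneg hba.le h0
  rw [← h1] at h2 ⊢
  nlinarith

theorem sum_sq_cellAverage_le {m : ℕ} (hm : 0 < m) {g : ℝ → ℝ}
    (hg : IntervalIntegrable g volume (-Real.pi) Real.pi)
    (hg2 : IntervalIntegrable (fun x => g x ^ 2) volume (-Real.pi) Real.pi) :
    ∑ i ∈ Finset.range m, cellAverage m g i ^ 2 ≤
      m / (2 * Real.pi) * ∫ ω in (-Real.pi)..Real.pi, g ω ^ 2 := by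
  have hm' : (0 : ℝ) < m := by positivity
  have hpi := Real.pi_pos
  rw [← sum_integral_cell hm hg2, Finset.mul_sum]
  refine Finset.sum_le_sum fun i hi => ?_
  have hi' := Finset.mem_range.1 hi
  have hlen := cellEdge_succ_sub m i
  have hpos : 0 < 2 * Real.pi / (m : ℝ) := by positivity
  have h := sq_integral_le (by linarith) (intervalIntegrable_cell hi' hg)
    (intervalIntegrable_cell hi' hg2)
  rw [hlen] at h
  rw [cellAverage, mul_pow]
  calc _ ≤ (m / (2 * Real.pi)) ^ 2 * (2 * Real.pi / m *
        ∫ x in (cellEdge m i)..(cellEdge m (i + 1)), g x ^ 2) :=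
        mul_le_mul_of_nonneg_left h (by positivity)
    _ = _ := by field_simp

/-- The attenuation of the frequency `k` caused by averaging over a cell. -/
def cellFactor (m : ℕ) (k : ℤ) : ℝ :=
  m / (2 * Real.pi) * ∫ h in (-(Real.pi / m))..(Real.pi / m), Real.cos (k * h)

theorem integral_sin_symm (k : ℤ) (a : ℝ) : ∫ h in (-a)..a, Real.sin (k * h) = 0 := by
  have h := intervalIntegral.integral_comp_neg (a := -a) (b := a) fun h => Real.sin (k * h)
  simp only [mul_neg, Real.sin_neg, intervalIntegral.integral_neg, neg_neg] at h
  linarith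

/-- The cell is symmetric about its midpoint `2π(i - q)/m`, a Fourier frequency because `m = 2q + 1`
is odd. In the addition formula the sine part integrates to zero. -/
theorem cellAverage_cos (q i : ℕ) (k : ℤ) :
    cellAverage (2 * q + 1) (fun ω => Real.cos (k * ω)) i = cellFactor (2 * q + 1) k *
      Real.cos (k * (2 * Real.pi * ((i : ℤ) - q : ℤ) / (2 * q + 1 : ℕ))) := by
  have hm : ((2 * q + 1 : ℕ) : ℝ) ≠ 0 := by positivity
  set w : ℝ := 2 * Real.pi * ((i : ℤ) - q : ℤ) / (2 * q + 1 : ℕ) with hw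
  have e1 : cellEdge (2 * q + 1) i = w + -(Real.pi / (2 * q + 1 : ℕ)) := by
    rw [hw, cellEdge]; push_cast; push_cast at hm; field_simp; ring
  have e2 : cellEdge (2 * q + 1) (i + 1) = w + Real.pi / (2 * q + 1 : ℕ) := by
    rw [hw, cellEdge]; push_cast; push_cast at hm; field_simp; ring
  rw [cellAverage, e1, e2, ← intervalIntegral.integral_comp_add_left, cellFactor]
  have e3 : ∀ h : ℝ, Real.cos (k * (w + h)) =
      Real.cos (k * w) * Real.cos (k * h) - Real.sin (k * w) * Real.sin (k * h) := fun h => by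
    rw [mul_add, Real.cos_add]
  simp only [e3]
  rw [intervalIntegral.integral_sub (Continuous.intervalIntegrable (by fun_prop) _ _)
    (Continuous.intervalIntegrable (by fun_prop) _ _), intervalIntegral.integral_const_mul,
    intervalIntegral.integral_const_mul, integral_sin_symm]
  ring

/-- Lipschitz continuity of the cosine is enough: only smoothness up to order one will be used. -/
theorem abs_cellFactor_sub_one_le {m : ℕ} (hm : 0 < m) (k : ℤ) :
    |cellFactor m k - 1| ≤ Real.pi * (|(k : ℝ)| / m) := by
  have hm' : (0 : ℝ) < m := by positivity
  have hpi := Real.pi_pos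
  have hlen : Real.pi / m - -(Real.pi / m) = 2 * Real.pi / (m : ℝ) := by ring
  have e : cellFactor m k - 1 = m / (2 * Real.pi) *
      ∫ h in (-(Real.pi / m))..(Real.pi / m), (Real.cos (k * h) - 1) := by
    rw [intervalIntegral.integral_sub (Continuous.intervalIntegrable (by fun_prop) _ _)
      intervalIntegrable_const, intervalIntegral.integral_const, hlen, cellFactor, smul_eq_mul,
      mul_sub]
    congr 1
    field_simp
  have hb := intervalIntegral.norm_integral_le_of_norm_le_const (a := -(Real.pi / m))
    (b := Real.pi / m) (f := fun h => Real.cos (k * h) - 1) (C := |(k : ℝ)| * (Real.pi / m))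
    fun h hh => by
      rw [Set.uIoc_of_le (by linarith [div_pos hpi hm'])] at hh
      have h1 := Real.abs_cos_sub_cos_le (k * h) 0
      rw [Real.cos_zero, sub_zero] at h1
      refine h1.trans ?_
      rw [abs_mul]
      exact mul_le_mul_of_nonneg_left (abs_le.2 ⟨hh.1.le, hh.2⟩) (abs_nonneg _)
  rw [hlen, Real.norm_eq_abs, abs_of_pos (by positivity : 0 < 2 * Real.pi / (m : ℝ))] at hb
  rw [e, abs_mul, abs_of_pos (by positivity : 0 < (m : ℝ) / (2 * Real.pi))]
  calc _ ≤ m / (2 * Real.pi) * (|(k : ℝ)| * (Real.pi / m) * (2 * Real.pi / m)) :=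
        mul_le_mul_of_nonneg_left hb (by positivity)
    _ = _ := by field_simp

theorem cellAverage_cosSum (q i : ℕ) (γ : ℤ → ℝ) :
    cellAverage (2 * q + 1) (cosSum q γ) i = ∑ k ∈ Finset.Icc (-q : ℤ) q,
      γ k * cellFactor (2 * q + 1) k *
        Real.cos (k * (2 * Real.pi * ((i : ℤ) - q : ℤ) / (2 * q + 1 : ℕ))) := by
  simp only [mul_assoc (γ _), ← cellAverage_cos]
  unfold cosSum
  rw [cellAverage, intervalIntegral.integral_finsetSum fun j _ =>
      Continuous.intervalIntegrable (by fun_prop) _ _, Finset.mul_sum]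
  refine Finset.sum_congr rfl fun k _ => ?_
  rw [intervalIntegral.integral_const_mul, cellAverage]
  ring

theorem sq_le_rpow_of_le_one {x β : ℝ} (h0 : 0 ≤ x) (h1 : x ≤ 1) (hβ0 : 0 < β) (hβ : β ≤ 1) :
    x ^ 2 ≤ x ^ (2 * β) := by
  rcases h0.eq_or_lt with rfl | h
  · rw [Real.zero_rpow (by linarith)]; norm_num
  · rw [← Real.rpow_natCast]
    exact Real.rpow_le_rpow_of_exponent_ge h h1 (by push_cast; linarith)

/-- Local averages of a density are close to the values of its truncated Fourier series. -/
theorem sum_sq_cellAverage_sub_cosSum_le {f : ℝ → ℝ}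
    (hf : MemLp f 2 (volume.restrict (Set.Ioc (-Real.pi) Real.pi)))
    (heven : ∀ ω ∈ Set.Icc (-Real.pi) Real.pi, f (-ω) = f ω) (q : ℕ) {β W : ℝ} (hβ0 : 0 < β)
    (hβ1 : β ≤ 1)
    (hsum : Summable fun k : ℤ => |(k : ℝ)| ^ (2 * β) * autocov f k ^ 2)
    (hW : ∑' k : ℤ, |(k : ℝ)| ^ (2 * β) * autocov f k ^ 2 ≤ W) :
    ∑ i ∈ Finset.range (2 * q + 1), (cellAverage (2 * q + 1) f i - (2 * Real.pi)⁻¹ *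
        cosSum q (autocov f) (2 * Real.pi * ((i : ℤ) - q : ℤ) / (2 * q + 1 : ℕ))) ^ 2 ≤
      W * ((2 * q + 1 : ℕ) : ℝ) ^ (1 - 2 * β) := by
  set m := 2 * q + 1 with hm
  set γ := autocov f with hγ
  have hm0 : 0 < m := by omega
  have hm' : (0 : ℝ) < m := by positivity
  have hpi := Real.pi_pos
  have hpi3 := Real.pi_gt_three
  have hfint := intervalIntegrable_of_memLp hf
  have hcont : Continuous fun ω => (2 * Real.pi)⁻¹ * cosSum q γ ω :=
    continuous_const.mul (continuous_cosSum q γ)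
  set g : ℝ → ℝ := fun ω => f ω - (2 * Real.pi)⁻¹ * cosSum q γ ω with hg
  have hgint : IntervalIntegrable g volume (-Real.pi) Real.pi :=
    hfint.sub (hcont.intervalIntegrable _ _)
  have hg2 : IntervalIntegrable (fun ω => g ω ^ 2) volume (-Real.pi) Real.pi := by
    refine intervalIntegrable_sq_of_memLp (hf.sub ?_)
    rw [memLp_two_iff_integrable_sq hcont.aestronglyMeasurable]
    exact ((hcont.pow 2).intervalIntegrable (-Real.pi) Real.pi).1
  have hW0 : 0 ≤ W := le_trans (tsum_nonneg fun k => by positivity) hW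
  have hW' : ∑ k ∈ Finset.Icc (-q : ℤ) q, |(k : ℝ)| ^ (2 * β) * γ k ^ 2 ≤ W :=
    (hsum.sum_le_tsum _ fun k _ => by positivity).trans hW
  have hmpow : (m : ℝ) * (m : ℝ) ^ (-(2 * β)) = (m : ℝ) ^ (1 - 2 * β) := by
    rw [sub_eq_add_neg, Real.rpow_add hm', Real.rpow_one]
  -- The error splits into the averaged Fourier tail `g` and the attenuation of the retained
  -- frequencies. Each is bounded by a quarter of the target, and the squared triangle inequality
  -- doubles both.
  have hdecomp : ∀ i ∈ Finset.range m, (cellAverage m f i - (2 * Real.pi)⁻¹ *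
      cosSum q γ (2 * Real.pi * ((i : ℤ) - q : ℤ) / m)) ^ 2 ≤ 2 * cellAverage m g i ^ 2 +
      2 * (∑ k ∈ Finset.Icc (-q : ℤ) q, ((2 * Real.pi)⁻¹ * (γ k * (cellFactor m k - 1))) *
        Real.cos (2 * Real.pi * k * ((i : ℝ) + (-q : ℤ)) / m)) ^ 2 := fun i hi => by
    have hi' := Finset.mem_range.1 hi
    have e1 : cellAverage m f i =
        cellAverage m g i + (2 * Real.pi)⁻¹ * cellAverage m (cosSum q γ) i := by
      rw [cellAverage, cellAverage, cellAverage, hg, intervalIntegral.integral_sub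
        (intervalIntegrable_cell hi' hfint) (hcont.intervalIntegrable _ _),
        intervalIntegral.integral_const_mul]
      ring
    have e2 : (2 * Real.pi)⁻¹ * cellAverage m (cosSum q γ) i - (2 * Real.pi)⁻¹ *
        cosSum q γ (2 * Real.pi * ((i : ℤ) - q : ℤ) / m) = ∑ k ∈ Finset.Icc (-q : ℤ) q,
        ((2 * Real.pi)⁻¹ * (γ k * (cellFactor m k - 1))) *
        Real.cos (2 * Real.pi * k * ((i : ℝ) + (-q : ℤ)) / m) := by
      rw [hm, cellAverage_cosSum, cosSum, ← mul_sub, ← Finset.sum_sub_distrib, Finset.mul_sum]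
      refine Finset.sum_congr rfl fun k _ => ?_
      have : (k : ℝ) * (2 * Real.pi * ((i : ℤ) - q : ℤ) / (2 * q + 1 : ℕ)) =
          2 * Real.pi * k * ((i : ℝ) + (-q : ℤ)) / (2 * q + 1 : ℕ) := by push_cast; ring
      rw [this]; ring
    rw [← e2, e1]
    set x := cellAverage m g i
    set y := (2 * Real.pi)⁻¹ * cellAverage m (cosSum q γ) i
    set z := (2 * Real.pi)⁻¹ * cosSum q γ (2 * Real.pi * ((i : ℤ) - q : ℤ) / m)
    nlinarith [sq_nonneg (x - (y - z))]
  refine (Finset.sum_le_sum hdecomp).trans ?_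
  rw [Finset.sum_add_distrib, ← Finset.mul_sum, ← Finset.mul_sum]
  have b1 : ∑ i ∈ Finset.range m, cellAverage m g i ^ 2 ≤ 1 / 4 * (W * (m : ℝ) ^ (1 - 2 * β)) := by
    have h1 := sum_sq_cellAverage_le hm0 hgint hg2
    have h2 := integral_sq_sub_cosSum_le hf heven q hβ0.le hsum hW
    -- `q + 1 ≥ m/2` and `β ≤ 1` give the factor `4`; then `4/(2π)² ≤ 1/4`.
    have h3 : ((q : ℝ) + 1) ^ (-(2 * β)) ≤ 4 * (m : ℝ) ^ (-(2 * β)) := by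
      have h4 : (m : ℝ) / 2 ≤ q + 1 := by rw [hm]; push_cast; linarith
      calc ((q : ℝ) + 1) ^ (-(2 * β)) ≤ ((m : ℝ) / 2) ^ (-(2 * β)) :=
            Real.rpow_le_rpow_of_nonpos (by positivity) h4 (by linarith)
        _ = 2 ^ (2 * β) * (m : ℝ) ^ (-(2 * β)) := by
            rw [Real.div_rpow hm'.le two_pos.le, Real.rpow_neg two_pos.le (2 * β), div_inv_eq_mul,
              mul_comm]
        _ ≤ 4 * (m : ℝ) ^ (-(2 * β)) := by
            refine mul_le_mul_of_nonneg_right ?_ (by positivity)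
            calc (2 : ℝ) ^ (2 * β) ≤ 2 ^ (2 : ℝ) :=
                  Real.rpow_le_rpow_of_exponent_le one_le_two (by linarith)
              _ = 4 := by norm_num
    have h5 := h2.trans (mul_le_mul_of_nonneg_right h3 hW0)
    set Q := ∫ ω in (-Real.pi)..Real.pi, g ω ^ 2
    have h6 : (m : ℝ) / (2 * Real.pi) * Q = m / (2 * Real.pi) ^ 2 * (2 * Real.pi * Q) := by
      field_simp
    rw [h6] at h1
    refine h1.trans ((mul_le_mul_of_nonneg_left h5 (by positivity)).trans ?_)
    rw [← hmpow]
    have h7 : (m : ℝ) / (2 * Real.pi) ^ 2 * (4 * (m : ℝ) ^ (-(2 * β)) * W) =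
      (4 / (2 * Real.pi) ^ 2) * (W * (m * (m : ℝ) ^ (-(2 * β)))) := by ring
    rw [h7]
    refine mul_le_mul_of_nonneg_right ?_ (by positivity)
    rw [div_le_iff₀ (by positivity)]
    nlinarith
  have b2 : ∑ i ∈ Finset.range m, (∑ k ∈ Finset.Icc (-q : ℤ) q,
      ((2 * Real.pi)⁻¹ * (γ k * (cellFactor m k - 1))) *
        Real.cos (2 * Real.pi * k * ((i : ℝ) + (-q : ℤ)) / m)) ^ 2 ≤
      1 / 4 * (W * (m : ℝ) ^ (1 - 2 * β)) := by
    refine (sum_sq_trigPoly_le q (-q) _).trans ?_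
    rw [← hm, ← hmpow]
    have hk : ∀ k ∈ Finset.Icc (-q : ℤ) q, ((2 * Real.pi)⁻¹ * (γ k * (cellFactor m k - 1))) ^ 2 ≤
        1 / 4 * (m : ℝ) ^ (-(2 * β)) * (|(k : ℝ)| ^ (2 * β) * γ k ^ 2) := fun k hk => by
      have h1 := abs_cellFactor_sub_one_le hm0 k
      have hkm : |(k : ℝ)| / m ≤ 1 := by
        rw [div_le_one hm']
        have : |k| ≤ (m : ℤ) := by
          rw [Finset.mem_Icc] at hk; rw [abs_le]; omega
        exact_mod_cast this
      have h2 : (cellFactor m k - 1) ^ 2 ≤ (Real.pi * (|(k : ℝ)| / m)) ^ 2 := by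
        rw [← sq_abs (cellFactor m k - 1)]; exact pow_le_pow_left₀ (abs_nonneg _) h1 2
      have h3 := sq_le_rpow_of_le_one (by positivity : 0 ≤ |(k : ℝ)| / m) hkm hβ0 hβ1
      have h4 : (|(k : ℝ)| / m) ^ (2 * β) = |(k : ℝ)| ^ (2 * β) * (m : ℝ) ^ (-(2 * β)) := by
        rw [Real.div_rpow (abs_nonneg _) hm'.le, Real.rpow_neg hm'.le, div_eq_mul_inv]
      have h5 : (cellFactor m k - 1) ^ 2 ≤
          Real.pi ^ 2 * (|(k : ℝ)| ^ (2 * β) * (m : ℝ) ^ (-(2 * β))) := by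
        rw [← h4]; rw [mul_pow] at h2
        exact h2.trans (mul_le_mul_of_nonneg_left h3 (by positivity))
      calc _ = ((2 * Real.pi)⁻¹ ^ 2 * γ k ^ 2) * (cellFactor m k - 1) ^ 2 := by ring
        _ ≤ ((2 * Real.pi)⁻¹ ^ 2 * γ k ^ 2) *
            (Real.pi ^ 2 * (|(k : ℝ)| ^ (2 * β) * (m : ℝ) ^ (-(2 * β)))) :=
          mul_le_mul_of_nonneg_left h5 (by positivity)
        _ = _ := by field_simp; ring
    have h6 := Finset.sum_le_sum hk
    rw [← Finset.mul_sum] at h6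
    have h7 := h6.trans (mul_le_mul_of_nonneg_left hW' (by positivity))
    calc _ ≤ (m : ℝ) * (1 / 4 * (m : ℝ) ^ (-(2 * β)) * W) :=
          mul_le_mul_of_nonneg_left h7 hm'.le
      _ = _ := by ring
  linarith

/-- The reflection `ω ↦ -ω` exchanges the two cells. This symmetry removes the non-Toeplitz part of
the Hartley covariance. -/
theorem cellAverage_symm {m i : ℕ} (hi : i < m) {f : ℝ → ℝ}
    (heven : ∀ ω ∈ Set.Icc (-Real.pi) Real.pi, f (-ω) = f ω) :
    cellAverage m f (m - 1 - i) = cellAverage m f i := by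
  have hm' : (m : ℝ) ≠ 0 := by
    have : m ≠ 0 := by omega
    exact_mod_cast this
  have hedge : ∀ j ≤ m, cellEdge m (m - j) = -cellEdge m j := fun j hj => by
    rw [cellEdge, cellEdge, Nat.cast_sub hj]; field_simp; ring
  have e1 : m - 1 - i = m - (i + 1) := by omega
  have e2 : m - 1 - i + 1 = m - i := by omega
  rw [cellAverage, cellAverage, e2, e1, hedge _ hi, hedge _ hi.le,
    ← intervalIntegral.integral_comp_neg]
  congr 1
  refine intervalIntegral.integral_congr fun ω hω => heven ω (cell_subset hi ?_)
  rwa [Set.uIcc_of_le (cellEdge_mono m (Nat.le_succ i))] at hω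

theorem le_cellAverage {m i : ℕ} (hi : i < m) {f : ℝ → ℝ} {c : ℝ}
    (hf : IntervalIntegrable f volume (-Real.pi) Real.pi)
    (hc : ∀ ω ∈ Set.Icc (-Real.pi) Real.pi, c ≤ f ω) : c ≤ cellAverage m f i := by
  have hm' : (0 : ℝ) < m := by
    have : 0 < m := by omega
    exact_mod_cast this
  have hpi := Real.pi_pos
  have h := intervalIntegral.integral_mono_on (cellEdge_mono m (Nat.le_succ i))
    intervalIntegrable_const (intervalIntegrable_cell hi hf) fun ω hω => hc ω (cell_subset hi hω)
  rw [intervalIntegral.integral_const, cellEdge_succ_sub, smul_eq_mul] at h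
  calc c = m / (2 * Real.pi) * (2 * Real.pi / m * c) := by field_simp
    _ ≤ _ := mul_le_mul_of_nonneg_left h (by positivity)

/-! ### The Hartley transform -/

/-- The grid frequencies `2π l / (2q + 1)`, `|l| ≤ q`, enumerated from `0` to `2q`. -/
def gridFreq (q i : ℕ) : ℝ := 2 * Real.pi * ((i : ℤ) - q : ℤ) / (2 * q + 1 : ℕ)

theorem gridFreq_reflect {q i : ℕ} (hi : i < 2 * q + 1) :
    gridFreq q (2 * q + 1 - 1 - i) = -gridFreq q i := by
  have : ((2 * q + 1 - 1 - i : ℕ) : ℤ) - q = -((i : ℤ) - q) := by omega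
  rw [gridFreq, gridFreq, this]; push_cast; ring

/-- The first `n` rows of the discrete Hartley transform of size `2q + 1`, scaled by `√(2π)`. -/
def hartley (n q : ℕ) : Matrix (Fin n) (Fin (2 * q + 1)) ℝ :=
  Matrix.of fun t j => √(2 * Real.pi / (2 * q + 1 : ℕ)) *
    (Real.cos (gridFreq q j * (t : ℕ)) + Real.sin (gridFreq q j * (t : ℕ)))

/-- From `(cos a + sin a)(cos b + sin b) = cos (a - b) + sin (a + b)`: the sine is odd in the
frequency and cancels against the symmetric `J`, which leaves a function of `t - s`. -/
theorem hartley_mul_diagonal_mul_transpose (n q : ℕ) (J : ℕ → ℝ)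
    (hJ : ∀ i < 2 * q + 1, J (2 * q + 1 - 1 - i) = J i) (s t : Fin n) :
    (hartley n q * Matrix.diagonal (fun j : Fin (2 * q + 1) => J j) *
      (hartley n q).transpose) s t = 2 * Real.pi / (2 * q + 1 : ℕ) *
      ∑ i ∈ Finset.range (2 * q + 1),
        J i * Real.cos (gridFreq q i * (((t : ℕ) : ℤ) - ((s : ℕ) : ℤ) : ℤ)) := by
  have hodd : ∑ i ∈ Finset.range (2 * q + 1),
      J i * Real.sin (gridFreq q i * ((s : ℕ) + (t : ℕ) : ℝ)) = 0 := by
    have h := Finset.sum_range_reflect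
      (fun i => J i * Real.sin (gridFreq q i * ((s : ℕ) + (t : ℕ) : ℝ))) (2 * q + 1)
    have h2 : ∑ i ∈ Finset.range (2 * q + 1), J (2 * q + 1 - 1 - i) *
        Real.sin (gridFreq q (2 * q + 1 - 1 - i) * ((s : ℕ) + (t : ℕ) : ℝ)) =
        -∑ i ∈ Finset.range (2 * q + 1),
          J i * Real.sin (gridFreq q i * ((s : ℕ) + (t : ℕ) : ℝ)) := by
      rw [← Finset.sum_neg_distrib]
      refine Finset.sum_congr rfl fun i hi => ?_
      have hi' := Finset.mem_range.1 hi
      rw [hJ i hi', gridFreq_reflect hi', neg_mul, Real.sin_neg, mul_neg]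
    linarith
  have hpos : (0 : ℝ) ≤ 2 * Real.pi / (2 * q + 1 : ℕ) := by positivity
  rw [Matrix.mul_apply]
  simp only [Matrix.mul_diagonal, Matrix.transpose_apply, hartley, Matrix.of_apply]
  rw [Fin.sum_univ_eq_sum_range (fun i => √(2 * Real.pi / (2 * q + 1 : ℕ)) *
    (Real.cos (gridFreq q i * (s : ℕ)) + Real.sin (gridFreq q i * (s : ℕ))) * J i *
    (√(2 * Real.pi / (2 * q + 1 : ℕ)) *
    (Real.cos (gridFreq q i * (t : ℕ)) + Real.sin (gridFreq q i * (t : ℕ)))))]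
  rw [← add_zero (∑ i ∈ Finset.range (2 * q + 1),
        J i * Real.cos (gridFreq q i * (((t : ℕ) : ℤ) - ((s : ℕ) : ℤ) : ℤ))), ← hodd,
    ← Finset.sum_add_distrib, Finset.mul_sum]
  refine Finset.sum_congr rfl fun i _ => ?_
  nth_rewrite 3 [← Real.mul_self_sqrt hpos]
  have e1 : gridFreq q i * ((((t : ℕ) : ℤ) - ((s : ℕ) : ℤ) : ℤ) : ℝ) =
    gridFreq q i * (t : ℕ) - gridFreq q i * (s : ℕ) := by push_cast; ring
  rw [e1, mul_add (gridFreq q i), Real.cos_sub, Real.sin_add]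
  ring

theorem hartley_mul_transpose {n q : ℕ} (hn : n ≤ 2 * q + 1) :
    hartley n q * (hartley n q).transpose = (2 * Real.pi) • (1 : Matrix (Fin n) (Fin n) ℝ) := by
  ext s t
  have h := hartley_mul_diagonal_mul_transpose n q (fun _ => 1) (fun _ _ => rfl) s t
  rw [Matrix.diagonal_one, Matrix.mul_one] at h
  have hm : ((2 * q + 1 : ℕ) : ℝ) ≠ 0 := by positivity
  have hc := sum_cos_grid (Nat.succ_pos (2 * q)) (((t : ℕ) : ℤ) - ((s : ℕ) : ℤ)) (-q : ℤ)
  have e : ∀ i : ℕ, (1 : ℝ) * Real.cos (gridFreq q i * (((t : ℕ) : ℤ) - ((s : ℕ) : ℤ) : ℤ)) =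
      Real.cos (2 * Real.pi * (((t : ℕ) : ℤ) - ((s : ℕ) : ℤ) : ℤ) * ((i : ℝ) + (-q : ℤ)) /
        (2 * q + 1 : ℕ)) := fun i => by
    rw [one_mul, gridFreq]; congr 1; push_cast; ring
  simp only [e] at h
  rw [h]
  simp only [Nat.succ_eq_add_one] at hc
  rw [hc]
  have hs := s.2
  have ht := t.2
  have hdvd : ((2 * q + 1 : ℕ) : ℤ) ∣ ((t : ℕ) : ℤ) - ((s : ℕ) : ℤ) ↔
      ((t : ℕ) : ℤ) - ((s : ℕ) : ℤ) = 0 :=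
    dvd_iff_eq_of_lt (by rw [abs_lt]; push_cast; omega)
  simp only [hdvd]
  by_cases hst : s = t
  · subst hst; simp only [sub_self, if_true, Matrix.smul_apply, Matrix.one_apply_eq, smul_eq_mul]
    field_simp
  · have hne : ¬ (((t : ℕ) : ℤ) - ((s : ℕ) : ℤ) = 0) := fun h0 => hst (Fin.ext (by omega))
    simp [hne, hst]

/-- With `y = Gᵀ x` the form is `∑ J j * y j ^ 2`, and `|y|² = 2π |x|²` by orthogonality of the
rows. -/
theorem le_dotProduct_hartley_mulVec {n q : ℕ} (hn : n ≤ 2 * q + 1) {c : ℝ}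
    {J : Fin (2 * q + 1) → ℝ} (hJ : ∀ j, c ≤ J j) (x : Fin n → ℝ) :
    2 * Real.pi * c * (x ⬝ᵥ x) ≤
      x ⬝ᵥ (hartley n q * Matrix.diagonal J * (hartley n q).transpose).mulVec x := by
  set y := (hartley n q).transpose.mulVec x with hy
  have e1 : ∀ v : Fin (2 * q + 1) → ℝ, x ⬝ᵥ (hartley n q).mulVec v = y ⬝ᵥ v := fun v => by
    rw [Matrix.dotProduct_mulVec, hy, Matrix.mulVec_transpose]
  have e2 : 2 * Real.pi * (x ⬝ᵥ x) = y ⬝ᵥ y := by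
    rw [← e1, hy, Matrix.mulVec_mulVec, hartley_mul_transpose hn, Matrix.smul_mulVec,
      Matrix.one_mulVec, dotProduct_smul, smul_eq_mul]
  rw [← Matrix.mulVec_mulVec, ← Matrix.mulVec_mulVec, e1, mul_right_comm, e2]
  simp only [dotProduct, Finset.sum_mul, Matrix.mulVec_diagonal]
  refine Finset.sum_le_sum fun j _ => ?_
  nlinarith [mul_le_mul_of_nonneg_right (hJ j) (mul_self_nonneg (y j))]

/-! ### Comparison of the covariance matrices -/

/-- Row by row this is Bessel's inequality with time and frequency exchanged: `t` is extended to a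
full period and `e` supplies the coefficients. At most `m` rows contribute `(2π/m)² m ∑ e²` each. -/
theorem sum_sq_gridSum_le {n q : ℕ} (hn : n ≤ 2 * q + 1) (e : ℕ → ℝ) :
    ∑ s ∈ Finset.range n, ∑ t ∈ Finset.range n, (2 * Real.pi / (2 * q + 1 : ℕ) *
      ∑ i ∈ Finset.range (2 * q + 1),
        e i * Real.cos (gridFreq q i * ((t : ℤ) - (s : ℤ) : ℤ))) ^ 2 ≤
      4 * Real.pi ^ 2 * ∑ i ∈ Finset.range (2 * q + 1), e i ^ 2 := by
  set m := 2 * q + 1 with hm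
  have hm' : (0 : ℝ) < m := by positivity
  have hE : 0 ≤ ∑ i ∈ Finset.range m, e i ^ 2 := Finset.sum_nonneg fun i _ => sq_nonneg _
  have hrow : ∀ s ∈ Finset.range n, ∑ t ∈ Finset.range n, (2 * Real.pi / m *
      ∑ i ∈ Finset.range m, e i * Real.cos (gridFreq q i * ((t : ℤ) - (s : ℤ) : ℤ))) ^ 2 ≤
      (2 * Real.pi / m) ^ 2 * (m * ∑ i ∈ Finset.range m, e i ^ 2) := fun s _ => by
    have h := sum_sq_trigPoly_le q (-(s : ℤ)) fun l => e (l + q).toNat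
    rw [← sum_range_eq_sum_Icc q fun l => e (l + q).toNat ^ 2] at h
    simp only [← sum_range_eq_sum_Icc q, sub_add_cancel, Int.toNat_natCast, ← hm] at h
    simp only [mul_pow, ← Finset.mul_sum]
    refine mul_le_mul_of_nonneg_left (le_trans ?_ h) (by positivity)
    refine (Finset.sum_le_sum_of_subset_of_nonneg (Finset.range_mono hn)
      fun _ _ _ => sq_nonneg _).trans (le_of_eq ?_)
    refine Finset.sum_congr rfl fun t _ => ?_
    congr 1
    refine Finset.sum_congr rfl fun i _ => ?_
    rw [gridFreq, ← hm]
    congr 2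
    push_cast; ring
  refine (Finset.sum_le_sum hrow).trans ?_
  rw [Finset.sum_const, Finset.card_range, nsmul_eq_mul]
  have hn' : (n : ℝ) ≤ m := by exact_mod_cast hn
  calc _ ≤ (m : ℝ) * ((2 * Real.pi / m) ^ 2 * (m * ∑ i ∈ Finset.range m, e i ^ 2)) :=
        mul_le_mul_of_nonneg_right hn' (by positivity)
    _ = _ := by field_simp; ring

theorem circulantCov_eq_gridSum (q : ℕ) (γ : ℤ → ℝ) (k : ℤ) :
    circulantCov q γ k = 2 * Real.pi / (2 * q + 1 : ℕ) * ∑ i ∈ Finset.range (2 * q + 1),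
      (2 * Real.pi)⁻¹ * cosSum q γ (gridFreq q i) * Real.cos (gridFreq q i * k) := by
  rw [circulantCov, ← sum_range_eq_sum_Icc, Finset.mul_sum, Finset.mul_sum]
  have hpi := Real.pi_pos.ne'
  refine Finset.sum_congr rfl fun i _ => ?_
  simp only [gridFreq]
  field_simp

/-- The entrywise difference is `D - E`, with `D` the wrap-around error and `E` the local averaging
error. The constant is `2 · 8 + 2 · 4π²`, and `m ≥ r + 1` merges the two rates. -/
theorem sum_sq_toeplitzCov_sub_le {f : ℝ → ℝ}
    (hf : MemLp f 2 (volume.restrict (Set.Ioc (-Real.pi) Real.pi)))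
    (heven : ∀ ω ∈ Set.Icc (-Real.pi) Real.pi, f (-ω) = f ω) {n r q : ℕ}
    (hnr : n + r = 2 * q + 1) (hrq : r ≤ q) {β W : ℝ} (hβ0 : 1 / 2 < β) (hβ1 : β ≤ 1)
    (hsum : Summable fun k : ℤ => |(k : ℝ)| ^ (2 * β) * autocov f k ^ 2)
    (hW : ∑' k : ℤ, |(k : ℝ)| ^ (2 * β) * autocov f k ^ 2 ≤ W) :
    ∑ s, ∑ t, (toeplitzCov n f s t - (hartley n q *
        Matrix.diagonal (localAverage (2 * q + 1) f) * (hartley n q).transpose) s t) ^ 2 ≤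
      (16 + 8 * Real.pi ^ 2) * W * ((r : ℝ) + 1) ^ (1 - 2 * β) := by
  have hfint := intervalIntegrable_of_memLp hf
  have hdiag : localAverage (2 * q + 1) f =
      fun j : Fin (2 * q + 1) => cellAverage (2 * q + 1) f j :=
    funext fun j => localAverage_eq_cellAverage _ f j
  have hW0 : 0 ≤ W := le_trans (tsum_nonneg fun k => by positivity) hW
  set e : ℕ → ℝ := fun i => cellAverage (2 * q + 1) f i -
    (2 * Real.pi)⁻¹ * cosSum q (autocov f) (gridFreq q i) with he
  set E : ℤ → ℝ := fun k => 2 * Real.pi / (2 * q + 1 : ℕ) * ∑ i ∈ Finset.range (2 * q + 1),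
    e i * Real.cos (gridFreq q i * k) with hE
  set D : ℤ → ℝ := fun k => autocov f k - circulantCov q (autocov f) k with hD
  have hentry : ∀ s t : Fin n, toeplitzCov n f s t - (hartley n q *
      Matrix.diagonal (localAverage (2 * q + 1) f) * (hartley n q).transpose) s t =
      D (((t : ℕ) : ℤ) - ((s : ℕ) : ℤ)) - E (((t : ℕ) : ℤ) - ((s : ℕ) : ℤ)) := fun s t => by
    rw [hdiag, hartley_mul_diagonal_mul_transpose n q (cellAverage (2 * q + 1) f)
      fun i hi => cellAverage_symm hi heven]
    simp only [hD, hE, he, circulantCov_eq_gridSum, toeplitzCov, Matrix.of_apply, sub_mul,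
      Finset.sum_sub_distrib, mul_sub]
    ring
  have hbound : ∀ s t : Fin n, (toeplitzCov n f s t - (hartley n q *
      Matrix.diagonal (localAverage (2 * q + 1) f) * (hartley n q).transpose) s t) ^ 2 ≤
      2 * D (((t : ℕ) : ℤ) - ((s : ℕ) : ℤ)) ^ 2 +
        2 * E (((t : ℕ) : ℤ) - ((s : ℕ) : ℤ)) ^ 2 := fun s t => by
    rw [hentry]
    nlinarith [sq_nonneg (D (((t : ℕ) : ℤ) - ((s : ℕ) : ℤ)) + E (((t : ℕ) : ℤ) - ((s : ℕ) : ℤ)))]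
  refine (Finset.sum_le_sum fun s _ => Finset.sum_le_sum fun t _ => hbound s t).trans ?_
  have hfin : ∀ F : ℤ → ℝ, ∑ s : Fin n, ∑ t : Fin n, F (((t : ℕ) : ℤ) - ((s : ℕ) : ℤ)) =
      ∑ s ∈ Finset.range n, ∑ t ∈ Finset.range n, F ((t : ℤ) - (s : ℤ)) := fun F => by
    rw [← Fin.sum_univ_eq_sum_range fun s => ∑ t ∈ Finset.range n, F ((t : ℤ) - (s : ℤ))]
    exact Finset.sum_congr rfl fun s _ =>
      Fin.sum_univ_eq_sum_range (fun t : ℕ => F ((t : ℤ) - ((s : ℕ) : ℤ))) n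
  rw [hfin fun k => 2 * D k ^ 2 + 2 * E k ^ 2]
  simp only [Finset.sum_add_distrib, ← Finset.mul_sum]
  have hr : (r : ℝ) ≤ q := by exact_mod_cast hrq
  have b1 := sum_sq_sub_circulantCov_le (ρ := r + 1) hnr (autocov_neg hfint) hβ0.le hsum hW
    (by positivity) (by linarith) le_rfl
  have b2 := sum_sq_gridSum_le (n := n) (q := q) (by omega) e
  have b3 := sum_sq_cellAverage_sub_cosSum_le hf heven q (by linarith) hβ1 hsum hW
  have b4 : ((2 * q + 1 : ℕ) : ℝ) ^ (1 - 2 * β) ≤ ((r : ℝ) + 1) ^ (1 - 2 * β) := by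
    refine Real.rpow_le_rpow_of_nonpos (by positivity) ?_ (by linarith)
    push_cast
    linarith [(Nat.cast_nonneg q : (0 : ℝ) ≤ q)]
  have b5 := b3.trans (mul_le_mul_of_nonneg_left b4 hW0)
  have b6 := b2.trans (mul_le_mul_of_nonneg_left b5 (by positivity))
  linarith

/-! ### The deficiency bound -/

/-- Smoothness beyond order one is discarded: for `|k| ≥ 1` lowering the exponent lowers the weight,
and at `k = 0` both weights vanish. -/
theorem densityClass_sobolev {α M : ℝ} (hα : 1 / 2 < α) {f : ℝ → ℝ} (hf : f ∈ densityClass α M) :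
    (Summable fun k : ℤ => |(k : ℝ)| ^ (2 * min α 1) * autocov f k ^ 2) ∧
      ∑' k : ℤ, |(k : ℝ)| ^ (2 * min α 1) * autocov f k ^ 2 ≤ M := by
  obtain ⟨⟨_, hsum, hle⟩, hlow⟩ := hf
  have hnorm : ∀ k, ‖fourierCoef f k‖ ^ 2 = autocov f k ^ 2 := fun k => by
    rw [← coe_autocov (fun ω hω => (hlow ω hω).2.symm) k, Complex.norm_real, Real.norm_eq_abs,
      sq_abs]
  simp only [hnorm] at hsum hle
  have hβ : 1 / 2 < min α 1 := lt_min hα (by norm_num)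
  have hterm : ∀ k : ℤ, |(k : ℝ)| ^ (2 * min α 1) * autocov f k ^ 2 ≤
      |(k : ℝ)| ^ (2 * α) * autocov f k ^ 2 := fun k => by
    refine mul_le_mul_of_nonneg_right ?_ (sq_nonneg _)
    rcases eq_or_ne k 0 with rfl | hk
    · rw [Int.cast_zero, abs_zero, Real.zero_rpow (by linarith), Real.zero_rpow (by linarith)]
    · refine Real.rpow_le_rpow_of_exponent_le ?_ (by linarith [min_le_left α 1])
      exact_mod_cast Int.one_le_abs hk
  have hsum' := Summable.of_nonneg_of_le (fun k => by positivity) hterm hsum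
  refine ⟨hsum', (hsum'.tsum_le_tsum hterm hsum).trans ?_⟩
  linarith [sq_nonneg (autocov f 0)]

theorem toeplitzCov_isHermitian {f : ℝ → ℝ}
    (hf : IntervalIntegrable f volume (-Real.pi) Real.pi) (n : ℕ) :
    (toeplitzCov n f).IsHermitian := by
  refine Matrix.IsHermitian.ext fun i j => ?_
  simp only [toeplitzCov, Matrix.of_apply, star_trivial]
  rw [← autocov_neg hf, neg_sub]

theorem deficiency_gaussianScale_timeSeries_le {α M : ℝ} (hα : 1 / 2 < α) (hM : 0 < M)
    {n r m : ℕ} (hnr : n + r = m) (hm : Odd m) (hrn : r < n)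
    (hsmall : (16 + 8 * Real.pi ^ 2) * M * ((r : ℝ) + 1) ^ (1 - 2 * min α 1) ≤
      (2 * Real.pi * M⁻¹) ^ 2 / 2) :
    deficiency (gaussianScale (densityClass α M) m) (timeSeries (densityClass α M) n) ≤
      ENNReal.ofReal (√(2 * ((16 + 8 * Real.pi ^ 2) * M * ((r : ℝ) + 1) ^ (1 - 2 * min α 1) /
        (2 * Real.pi * M⁻¹) ^ 2))) := by
  obtain ⟨q, rfl⟩ := hm
  have hmeas : Measurable (hartley n q).toEuclideanLin :=
    (LinearMap.continuous_of_finiteDimensional _).measurable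
  refine iInf₂_le_of_le (Kernel.deterministic _ hmeas) inferInstance (iSup_le fun ⟨f, hfS⟩ => ?_)
  obtain ⟨hsum, hW⟩ := densityClass_sobolev hα hfS
  obtain ⟨⟨hL2, -⟩, hlow⟩ := hfS
  have hf := memLp_Ioc_of_Icc hL2
  have hfint := intervalIntegrable_of_memLp hf
  have hJ : ∀ j, M⁻¹ ≤ localAverage (2 * q + 1) f j := fun j => by
    rw [localAverage_eq_cellAverage]
    exact le_cellAverage j.2 hfint fun ω hω => (hlow ω hω).1
  have hpos : (Matrix.diagonal (localAverage (2 * q + 1) f)).PosSemidef :=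
    Matrix.PosSemidef.diagonal fun j => (inv_nonneg.2 hM.le).trans (hJ j)
  have hB := hpos.mul_mul_conjTranspose_same (hartley n q)
  rw [Matrix.conjTranspose_eq_transpose_of_trivial] at hB
  -- The order is swapped so that the image covariance, whose lower bound is explicit, becomes the
  -- reference matrix.
  rw [Measure.deterministic_comp_eq_map, tvDist_comm]
  simp only [gaussianScale, timeSeries]
  rw [map_multivariateGaussian hpos]
  refine tvDist_multivariateGaussian_le hB.1 (toeplitzCov_isHermitian hfint n)
    (by have := Real.pi_pos; positivity)
    (le_dotProduct_hartley_mulVec (by omega) hJ) ?_ hsmall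
  exact sum_sq_toeplitzCov_sub_le hf (fun ω hω => (hlow ω hω).2.symm) hnr (by omega)
    (lt_min hα (by norm_num)) (min_le_right _ _) hsum hW

/-- `log x ≤ x - 1` gives `2 log (n/2) ≤ n - 2`; when the logarithm is negative the natural floor is
`0`. -/
theorem extraGrid_lt {n : ℕ} (hn : 0 < n) : extraGrid n < n := by
  have hn' : (0 : ℝ) < n := by positivity
  rcases le_or_gt 0 (Real.log ((n : ℝ) / 2)) with h | h
  · have h1 := Real.log_le_sub_one_of_pos (show (0 : ℝ) < n / 2 by positivity)
    have h2 := Nat.floor_le h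
    have h3 : ((extraGrid n : ℕ) : ℝ) < n := by
      rw [extraGrid]; push_cast; linarith
    exact_mod_cast h3
  · rw [extraGrid, Nat.floor_of_nonpos h.le]; omega

theorem tendsto_extraGrid_add_one :
    Tendsto (fun n => (extraGrid n : ℝ) + 1) atTop atTop := by
  have h1 : Tendsto (fun n : ℕ => Real.log ((n : ℝ) / 2)) atTop atTop :=
    Real.tendsto_log_atTop.comp (tendsto_natCast_atTop_atTop.atTop_div_const two_pos)
  refine tendsto_atTop_mono (fun n => ?_) h1
  have h2 := (Nat.lt_floor_add_one (Real.log ((n : ℝ) / 2))).le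
  rw [extraGrid]; push_cast
  linarith [(Nat.cast_nonneg ⌊Real.log ((n : ℝ) / 2)⌋₊ : (0 : ℝ) ≤ _)]

end SpectralExperiment

end

/-! ### Passage to the limit. -/

theorem mainTheorem3 (α M : ℝ) (hα : 1 / 2 < α) (hM : 0 < M) :
    SpectralExperiment.AsympLessInformative (atTop ⊓ 𝓟 {n : ℕ | Odd n})
      (fun n => SpectralExperiment.timeSeries (SpectralExperiment.densityClass α M) n)
      (fun n => SpectralExperiment.gaussianScale (SpectralExperiment.densityClass α M)
        (n + SpectralExperiment.extraGrid n)) := by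
  have hβ : 1 / 2 < min α 1 := lt_min hα (by norm_num)
  have hpi := Real.pi_pos
  have hrate : Tendsto (fun n => (16 + 8 * Real.pi ^ 2) * M *
      ((SpectralExperiment.extraGrid n : ℝ) + 1) ^ (1 - 2 * min α 1)) atTop (𝓝 0) := by
    have h := (tendsto_rpow_neg_atTop (y := 2 * min α 1 - 1) (by linarith)).comp
      SpectralExperiment.tendsto_extraGrid_add_one
    have h2 := h.const_mul ((16 + 8 * Real.pi ^ 2) * M)
    simpa only [mul_zero, Function.comp_def, neg_sub] using h2
  have hlim : Tendsto (fun n => ENNReal.ofReal (√(2 * ((16 + 8 * Real.pi ^ 2) * M *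
      ((SpectralExperiment.extraGrid n : ℝ) + 1) ^ (1 - 2 * min α 1) /
        (2 * Real.pi * M⁻¹) ^ 2)))) atTop (𝓝 0) := by
    have h := ENNReal.tendsto_ofReal
      (((hrate.div_const ((2 * Real.pi * M⁻¹) ^ 2)).const_mul 2).sqrt)
    simpa using h
  have hsmall := hrate.eventually_le_const
    (show (0 : ℝ) < (2 * Real.pi * M⁻¹) ^ 2 / 2 by positivity)
  refine tendsto_of_tendsto_of_tendsto_of_le_of_le' tendsto_const_nhds (hlim.mono_left inf_le_left)
    (Eventually.of_forall fun _ => zero_le) ?_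
  rw [eventually_inf_principal]
  filter_upwards [hsmall, eventually_gt_atTop 0] with n hn hn0 hodd
  -- `r_n` is even, so an odd `n` yields an odd grid size.
  exact SpectralExperiment.deficiency_gaussianScale_timeSeries_le hα hM rfl
    (hodd.add_even (even_two_mul _)) (SpectralExperiment.extraGrid_lt hn0) hn
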